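/- Let $M$ be a smooth manifold, $\Omega_M$ its differential forms and $\mathcal E_M$ the algebra of (local) $\mathbb R$-linear operators on $\Omega_M$, with graded commutator $[A,B]=AB-(-1)^{\deg A\deg B}BA$ and $\mathrm{ad}_A=[A,\cdot\,]$. Sections $X+\alpha$ of the generalized tangent bundle $\mathbb TM=TM\oplus T^*M$ are regarded as elements of $\mathcal E_M$ acting by $\omega\mapsto\iota_X\omega+\alpha\wedge\omega$, and $\langle\mathbf x,\mathbf y\rangle=\tfrac12[\mathbf x,\mathbf y]$ is the tautological inner product on $\mathbb TM$. Let $\varphi$ be a generalized polynomial structure with minimal polynomial $P$, that is, a smooth bundle endomorphism of $\mathbb TM$, skew-symmetric for $\langle\cdot,\cdot\rangle$, such that the minimal polynomial of $\varphi_p$ is the same real polynomial $P$ of positive degree for all $p\in M$. Write $$P(x)=\prod_{\lambda\in\Sigma}(x-\lambda)^{m(\lambda)},$$ where $\Sigma\subset\mathbb C$ is the set of eigenvalues of $\varphi$ on $\mathbb TM\otimes\mathbb C$. Then there is a unique even $\widetilde\varphi\in\mathcal E_M$ such that $[\widetilde\varphi,f]=0$ for all functions $f$, $[\widetilde\varphi,\mathbf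 x]=\varphi(\mathbf x)$ for all sections $\mathbf x$ of $\mathbb TM$, and $\widetilde\varphi(1)\in\Omega^2_M$. Call $\varphi$ minimal if its minimal torsion $(\mathbf x,\mathbf y)\mapsto[[\mathbf x,\delta_\varphi],\mathbf y]$, where $\delta_\varphi=P(\mathrm{ad}_{\widetilde\varphi})(d)$ and $d$ is the de Rham operator, vanishes for all sections $\mathbf x,\mathbf y$ of $\mathbb TM$. (1) $\varphi$ is minimal if and only if there are $d_\lambda\in\mathcal E_M\otimes\mathbb C$, $\lambda\in\Sigma$, with $d=\sum_{\lambda\in\Sigma}d_\lambda$ such that $(\mathrm{ad}_{\widetilde\varphi}-\lambda)^{m(\lambda)}(d_\lambda)$ is a section of $\mathbb TM\otimes\mathbb C$ for every $\lambda\in\Sigma$. (2) There are numbers $a_{\lambda,i}\in\mathbb C$ with $\frac1{P(x)}=\sum_{\lambda\in\Sigma}\sum_{i=1}^{m(\lambda)}\frac{a_{\lambda,i}}{(x-\lambda)^i}$. For such $a_{\lambda,i}$, with $Q_{\lambda,i}(x)=P(x)/(x-\lambda)^i$, the operators $$d_\lambda=\sum_{i=1}^{m(\lambda)}a_{\lambda,i}\,Q_{\lambda,i}(\mathrm{ad}_{\widetilde\varphi})(d)$$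 satisfy $d=\sum_{\lambda\in\Sigma}d_\lambda$, and $\varphi$ is minimal if and only if $(\mathrm{ad}_{\widetilde\varphi}-\lambda)^{m(\lambda)}(d_\lambda)$ is a section of $\mathbb TM\otimes\mathbb C$ for every $\lambda\in\Sigma$. -/

import Mathlib

open scoped Manifold ContDiff TensorProduct

set_option linter.unusedSectionVars false

noncomputable section

namespace GenGeom

section Local

variable {E : Type*} [NormedAddCommGroup E] [NormedSpace ℝ E]
  {M : Type*} [TopologicalSpace M] [ChartedSpace E M] [IsManifold 𝓘(ℝ, E) ∞ M]

/-! ### Differential forms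

`M` is a smooth manifold modelled on `E`. In Mathlib the tangent space `TangentSpace 𝓘(ℝ, E) p` is
by definition `E`, identified with the geometric tangent space by the preferred chart at `p`, and
`tangentCoordChange 𝓘(ℝ, E) x y p` is the derivative at `p` of the change of coordinates from the
preferred chart at `x` to the preferred chart at `y`. -/

/-- The expression of a `k`-form `η` in the preferred chart at `x₀`, i.e. the pullback of `η` by
the inverse of this chart: a `k`-form on the target of the chart. -/
def chartForm {k : ℕ} (η : M → E [⋀^Fin k]→L[ℝ] ℝ) (x₀ : M) (y : E) : E [⋀^Fin k]→L[ℝ] ℝ :=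
  (η ((extChartAt 𝓘(ℝ, E) x₀).symm y)).compContinuousLinearMap
    (tangentCoordChange 𝓘(ℝ, E) x₀ ((extChartAt 𝓘(ℝ, E) x₀).symm y)
      ((extChartAt 𝓘(ℝ, E) x₀).symm y))

/-- A `k`-form is smooth if it is smooth in charts. -/
def IsSmoothForm {k : ℕ} (η : M → E [⋀^Fin k]→L[ℝ] ℝ) : Prop :=
  ∀ x₀ : M, ContDiffOn ℝ ∞ (chartForm η x₀) (extChartAt 𝓘(ℝ, E) x₀).target

/-- The expression of a covector field in the preferred chart at `x₀`. -/
def chartCovector (α : M → E →L[ℝ] ℝ) (x₀ : M) (y : E) : E →L[ℝ] ℝ :=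
  (α ((extChartAt 𝓘(ℝ, E) x₀).symm y)).comp
    (tangentCoordChange 𝓘(ℝ, E) x₀ ((extChartAt 𝓘(ℝ, E) x₀).symm y)
      ((extChartAt 𝓘(ℝ, E) x₀).symm y))

/-- A covector field is smooth if it is smooth in charts. -/
def IsSmoothCovector (α : M → E →L[ℝ] ℝ) : Prop :=
  ∀ x₀ : M, ContDiffOn ℝ ∞ (chartCovector α x₀) (extChartAt 𝓘(ℝ, E) x₀).target

/-- A vector field is smooth if it is a smooth section of the tangent bundle. -/
def IsSmoothVector (X : M → E) : Prop :=
  ContMDiff 𝓘(ℝ, E) 𝓘(ℝ, E).tangent ∞ (fun p => (⟨p, X p⟩ : TangentBundle 𝓘(ℝ, E) M))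

/-- The exterior derivative of a `k`-form, computed at `p` in the preferred chart at `p`. -/
def extD {k : ℕ} (η : M → E [⋀^Fin k]→L[ℝ] ℝ) (p : M) : E [⋀^Fin (k + 1)]→L[ℝ] ℝ :=
  extDeriv (chartForm η p) (extChartAt 𝓘(ℝ, E) p p)

/-- The wedge product `α ∧ η` of a covector and an alternating `k`-form:
`(α ∧ η)(v₀, …, v_k) = ∑ i, (-1)^i α(v_i) η(v₀, …, v̂_i, …, v_k)`. -/
def wedge {k : ℕ} (α : E →L[ℝ] ℝ) (η : E [⋀^Fin k]→L[ℝ] ℝ) : E [⋀^Fin (k + 1)]→L[ℝ] ℝ :=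
  ContinuousAlternatingMap.alternatizeUncurryFin (α.smulRight η)

/-- The contraction `ι_v η = η(v, …)`. -/
def contract {k : ℕ} (v : E) (η : E [⋀^Fin (k + 1)]→L[ℝ] ℝ) : E [⋀^Fin k]→L[ℝ] ℝ :=
  η.curryLeft v

/-! ### Smoothness of the basic operations -/

theorem mem_target_source {x₀ : M} {y : E} (hy : y ∈ (extChartAt 𝓘(ℝ, E) x₀).target) :
    (extChartAt 𝓘(ℝ, E) x₀).symm y ∈ (extChartAt 𝓘(ℝ, E) x₀).source :=
  (extChartAt 𝓘(ℝ, E) x₀).map_target hy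

theorem isOpen_chart_target (x₀ : M) : IsOpen (extChartAt 𝓘(ℝ, E) x₀).target :=
  isOpen_extChartAt_target x₀

theorem chartForm_extD {k : ℕ} {η : M → E [⋀^Fin k]→L[ℝ] ℝ} (hη : IsSmoothForm η) (x₀ : M)
    {y : E} (hy : y ∈ (extChartAt 𝓘(ℝ, E) x₀).target) :
    chartForm (extD η) x₀ y = extDeriv (chartForm η x₀) y := by
  set q := (extChartAt 𝓘(ℝ, E) x₀).symm y with hq
  have hq0 : q ∈ (extChartAt 𝓘(ℝ, E) x₀).source := mem_target_source hy
  have hqq : q ∈ (extChartAt 𝓘(ℝ, E) q).source := mem_extChartAt_source q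
  have hyq : extChartAt 𝓘(ℝ, E) x₀ q = y := (extChartAt 𝓘(ℝ, E) x₀).right_inv hy
  set f : E → E := extChartAt 𝓘(ℝ, E) q ∘ (extChartAt 𝓘(ℝ, E) x₀).symm with hf
  have hfy : f y = extChartAt 𝓘(ℝ, E) q q := rfl
  have hopen : IsOpen ((extChartAt 𝓘(ℝ, E) x₀).target ∩
      (extChartAt 𝓘(ℝ, E) x₀).symm ⁻¹' (extChartAt 𝓘(ℝ, E) q).source) :=
    (continuousOn_extChartAt_symm x₀).isOpen_inter_preimage (isOpen_chart_target x₀)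
      (isOpen_extChartAt_source q)
  have key : ∀ y' ∈ (extChartAt 𝓘(ℝ, E) x₀).target ∩
      (extChartAt 𝓘(ℝ, E) x₀).symm ⁻¹' (extChartAt 𝓘(ℝ, E) q).source,
      fderiv ℝ f y' = tangentCoordChange 𝓘(ℝ, E) x₀ q ((extChartAt 𝓘(ℝ, E) x₀).symm y') := by
    intro y' hy'
    rw [tangentCoordChange_def, (extChartAt 𝓘(ℝ, E) x₀).right_inv hy'.1]
    simp [hf]
  have hev : chartForm η x₀ =ᶠ[nhds y]
      fun y' => (chartForm η q (f y')).compContinuousLinearMap (fderiv ℝ f y') := by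
    filter_upwards [hopen.mem_nhds ⟨hy, hqq⟩] with y' hy'
    have h1 : (extChartAt 𝓘(ℝ, E) q).symm (f y') = (extChartAt 𝓘(ℝ, E) x₀).symm y' :=
      (extChartAt 𝓘(ℝ, E) q).left_inv hy'.2
    rw [key y' hy']
    ext v
    simp only [chartForm, h1, ContinuousAlternatingMap.compContinuousLinearMap_apply]
    congr 1
    funext i
    exact (tangentCoordChange_comp (I := 𝓘(ℝ, E))
      ⟨⟨mem_target_source hy'.1, hy'.2⟩, mem_extChartAt_source _⟩).symm
  rw [hev.extDeriv_eq, extDeriv_pullback (r := ∞)]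
  · rw [key y ⟨hy, hqq⟩]; rfl
  · exact ((hη q).contDiffAt ((isOpen_chart_target q).mem_nhds
      (mem_extChartAt_target q))).differentiableAt (by simp)
  · have := contDiffWithinAt_ext_coord_change (I := 𝓘(ℝ, E)) (n := ∞) q x₀ (y := y)
      (by rw [PartialEquiv.trans_source]; exact ⟨hy, hqq⟩)
    simpa [contDiffWithinAt_univ, hf] using this
  · simpa using (WithTop.coe_le_coe.2 (le_top : (2 : ℕ∞) ≤ ⊤))

theorem IsSmoothForm.extD {k : ℕ} {η : M → E [⋀^Fin k]→L[ℝ] ℝ} (hη : IsSmoothForm η) :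
    IsSmoothForm (extD η) := by
  intro x₀
  have h : ContDiffOn ℝ ∞ (extDeriv (chartForm η x₀)) (extChartAt 𝓘(ℝ, E) x₀).target :=
    (ContinuousAlternatingMap.alternatizeUncurryFinCLM ℝ E ℝ).contDiff.comp_contDiffOn
      ((hη x₀).fderiv_of_isOpen (isOpen_chart_target x₀) (by simp))
  exact h.congr fun y hy => chartForm_extD hη x₀ hy

theorem IsSmoothForm.wedge {k : ℕ} {η : M → E [⋀^Fin k]→L[ℝ] ℝ} {α : M → E →L[ℝ] ℝ}
    (hα : IsSmoothCovector α) (hη : IsSmoothForm η) :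
    IsSmoothForm (fun p => wedge (α p) (η p)) := by
  intro x₀
  have h := (ContinuousAlternatingMap.alternatizeUncurryFinCLM
    (n := k) ℝ E ℝ).contDiff.comp_contDiffOn ((hα x₀).smulRight (hη x₀))
  refine h.congr fun y _ => ?_
  ext v
  simp only [chartForm, chartCovector, GenGeom.wedge, Function.comp_apply,
    ContinuousAlternatingMap.alternatizeUncurryFinCLM_apply,
    ContinuousAlternatingMap.alternatizeUncurryFin_apply,
    ContinuousAlternatingMap.compContinuousLinearMap_apply, ContinuousLinearMap.smulRight_apply,
    ContinuousLinearMap.comp_apply, ContinuousAlternatingMap.smul_apply, Function.comp_apply]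
  rfl

theorem IsSmoothVector.chart {X : M → E} (hX : IsSmoothVector X) (x₀ : M) :
    ContDiffOn ℝ ∞ (fun y => tangentCoordChange 𝓘(ℝ, E) ((extChartAt 𝓘(ℝ, E) x₀).symm y) x₀
      ((extChartAt 𝓘(ℝ, E) x₀).symm y) (X ((extChartAt 𝓘(ℝ, E) x₀).symm y)))
      (extChartAt 𝓘(ℝ, E) x₀).target := by
  have h1 : ContMDiffOn 𝓘(ℝ, E) 𝓘(ℝ, E) ∞
      (fun q => tangentCoordChange 𝓘(ℝ, E) q x₀ q (X q)) (extChartAt 𝓘(ℝ, E) x₀).source := by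
    have h2 := (Bundle.Trivialization.contMDiffOn_section_baseSet_iff (IB := 𝓘(ℝ, E)) (n := ∞)
      (e := trivializationAt E (TangentSpace 𝓘(ℝ, E) (M := M)) x₀)
      (E := TangentSpace 𝓘(ℝ, E)) (s := X)).1 hX.contMDiffOn
    rw [TangentBundle.trivializationAt_baseSet, ← extChartAt_source 𝓘(ℝ, E)] at h2
    exact h2
  have h3 := h1.comp (contMDiffOn_extChartAt_symm (I := 𝓘(ℝ, E)) (n := ∞) x₀)
    (fun y hy => mem_target_source hy)
  exact contMDiffOn_iff_contDiffOn.1 h3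

theorem IsSmoothForm.contract {k : ℕ} {η : M → E [⋀^Fin (k + 1)]→L[ℝ] ℝ} {X : M → E}
    (hX : IsSmoothVector X) (hη : IsSmoothForm η) :
    IsSmoothForm (fun p => contract (X p) (η p)) := by
  intro x₀
  have h := (((ContinuousAlternatingMap.curryLeftLI (𝕜 := ℝ) (E := E) (F := ℝ)
      (n := k)).toContinuousLinearMap.contDiff.comp_contDiffOn (hη x₀))).clm_apply (hX.chart x₀)
  refine h.congr fun y hy => ?_
  have hq0 := mem_target_source hy
  have e : tangentCoordChange 𝓘(ℝ, E) x₀ ((extChartAt 𝓘(ℝ, E) x₀).symm y)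
      ((extChartAt 𝓘(ℝ, E) x₀).symm y)
      (tangentCoordChange 𝓘(ℝ, E) ((extChartAt 𝓘(ℝ, E) x₀).symm y) x₀
      ((extChartAt 𝓘(ℝ, E) x₀).symm y) (X ((extChartAt 𝓘(ℝ, E) x₀).symm y))) =
      X ((extChartAt 𝓘(ℝ, E) x₀).symm y) := by
    rw [tangentCoordChange_comp ⟨⟨mem_extChartAt_source _, hq0⟩, mem_extChartAt_source _⟩,
      tangentCoordChange_self (mem_extChartAt_source _)]
  ext v
  simp only [chartForm, GenGeom.contract, ContinuousAlternatingMap.compContinuousLinearMap_apply,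
    Function.comp_apply, LinearIsometry.coe_toContinuousLinearMap]
  simp only [ContinuousAlternatingMap.curryLeftLI_apply, ContinuousAlternatingMap.curryLeft_apply_apply,
    ContinuousAlternatingMap.compContinuousLinearMap_apply]
  congr 1
  funext i
  refine Fin.cases ?_ (fun j => ?_) i
  · simpa using e.symm
  · simp

theorem IsSmoothForm.smul {k : ℕ} {η : M → E [⋀^Fin k]→L[ℝ] ℝ} (f : C^∞⟮𝓘(ℝ, E), M; ℝ⟯)
    (hη : IsSmoothForm η) : IsSmoothForm (fun p => f p • η p) := by
  intro x₀
  have h1 : ContDiffOn ℝ ∞ (f ∘ (extChartAt 𝓘(ℝ, E) x₀).symm) (extChartAt 𝓘(ℝ, E) x₀).target :=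
    contMDiffOn_iff_contDiffOn.1
      (f.contMDiff.comp_contMDiffOn (contMDiffOn_extChartAt_symm (I := 𝓘(ℝ, E)) (n := ∞) x₀))
  exact (h1.smul (hη x₀)).congr fun y _ => by ext v; simp [chartForm]

theorem IsSmoothForm.add {k : ℕ} {η ζ : M → E [⋀^Fin k]→L[ℝ] ℝ} (hη : IsSmoothForm η)
    (hζ : IsSmoothForm ζ) : IsSmoothForm (η + ζ) := fun x₀ =>
  ((hη x₀).add (hζ x₀)).congr fun y _ => by ext v; simp [chartForm]

theorem IsSmoothForm.const_smul {k : ℕ} {η : M → E [⋀^Fin k]→L[ℝ] ℝ} (c : ℝ)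
    (hη : IsSmoothForm η) : IsSmoothForm (c • η) := fun x₀ =>
  ((hη x₀).const_smul c).congr fun y _ => by ext v; simp [chartForm]

theorem IsSmoothForm.zero {k : ℕ} : IsSmoothForm (0 : M → E [⋀^Fin k]→L[ℝ] ℝ) := fun x₀ =>
  (contDiffOn_const (c := 0)).congr fun y _ => by ext v; simp [chartForm]

theorem IsSmoothForm.constZero (c : ℝ) : IsSmoothForm
    (fun _ : M => ContinuousAlternatingMap.constOfIsEmpty ℝ E (Fin 0) c) := fun x₀ =>
  (contDiffOn_const (c := ContinuousAlternatingMap.constOfIsEmpty ℝ E (Fin 0) c)).congr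
    fun y _ => by ext v; simp [chartForm]

theorem extD_add {k : ℕ} {η ζ : M → E [⋀^Fin k]→L[ℝ] ℝ} (hη : IsSmoothForm η)
    (hζ : IsSmoothForm ζ) : extD (η + ζ) = extD η + extD ζ := by
  funext p
  have h : ∀ {θ : M → E [⋀^Fin k]→L[ℝ] ℝ}, IsSmoothForm θ →
      DifferentiableAt ℝ (chartForm θ p) (extChartAt 𝓘(ℝ, E) p p) := fun {θ} hθ =>
    ((hθ p).contDiffAt ((isOpen_chart_target p).mem_nhds
      (mem_extChartAt_target p))).differentiableAt (by simp)
  have e : chartForm (η + ζ) p = chartForm η p + chartForm ζ p := by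
    ext y v; simp [chartForm]
  simp only [extD, e, extDeriv_add (h hη) (h hζ), Pi.add_apply]

theorem extD_smul {k : ℕ} (c : ℝ) (η : M → E [⋀^Fin k]→L[ℝ] ℝ) :
    extD (c • η) = c • extD η := by
  funext p
  have e : chartForm (c • η) p = c • chartForm η p := by
    ext y v; simp [chartForm]
  simp only [extD, e, extDeriv_smul, Pi.smul_apply]

theorem extD_local {k : ℕ} {η : M → E [⋀^Fin k]→L[ℝ] ℝ} {U : Set M} (hU : IsOpen U)
    (h : ∀ p ∈ U, η p = 0) : ∀ p ∈ U, extD η p = 0 := by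
  intro p hp
  have hev : chartForm η p =ᶠ[nhds (extChartAt 𝓘(ℝ, E) p p)] fun _ => 0 := by
    have hc : ContinuousAt (extChartAt 𝓘(ℝ, E) p).symm (extChartAt 𝓘(ℝ, E) p p) :=
      continuousAt_extChartAt_symm p
    have : (extChartAt 𝓘(ℝ, E) p).symm ⁻¹' U ∈ nhds (extChartAt 𝓘(ℝ, E) p p) :=
      hc.preimage_mem_nhds (by rw [extChartAt_to_inv]; exact hU.mem_nhds hp)
    filter_upwards [this] with y hy
    ext v
    simp only [chartForm, h _ hy, ContinuousAlternatingMap.compContinuousLinearMap_apply]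
    rfl
  have e : fderiv ℝ (fun _ : E => (0 : E [⋀^Fin k]→L[ℝ] ℝ)) = 0 := by ext; simp
  rw [extD, hev.extDeriv_eq, extDeriv, e]
  ext v
  simp [ContinuousAlternatingMap.alternatizeUncurryFin_apply]

theorem IsSmoothCovector.add {α β : M → E →L[ℝ] ℝ} (hα : IsSmoothCovector α)
    (hβ : IsSmoothCovector β) : IsSmoothCovector (α + β) := fun x₀ =>
  ((hα x₀).add (hβ x₀)).congr fun y _ => by ext v; simp [chartCovector]

theorem IsSmoothCovector.const_smul {α : M → E →L[ℝ] ℝ} (c : ℝ) (hα : IsSmoothCovector α) :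
    IsSmoothCovector (c • α) := fun x₀ =>
  ((hα x₀).const_smul c).congr fun y _ => by ext v; simp [chartCovector]

theorem IsSmoothCovector.zero : IsSmoothCovector (0 : M → E →L[ℝ] ℝ) := fun x₀ =>
  (contDiffOn_const (c := 0)).congr fun y _ => by ext v; simp [chartCovector]

theorem IsSmoothVector.add {X Y : M → E} (hX : IsSmoothVector X) (hY : IsSmoothVector Y) :
    IsSmoothVector (X + Y) :=
  ContMDiff.add_section (V := (TangentSpace 𝓘(ℝ, E) : M → Type _)) hX hY

theorem IsSmoothVector.const_smul {X : M → E} (c : ℝ) (hX : IsSmoothVector X) :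
    IsSmoothVector (c • X) :=
  ContMDiff.const_smul_section (V := (TangentSpace 𝓘(ℝ, E) : M → Type _)) (a := c) hX

theorem IsSmoothVector.zero : IsSmoothVector (0 : M → E) :=
  Bundle.contMDiff_zeroSection ℝ (TangentSpace 𝓘(ℝ, E) : M → Type _)

theorem wedge_add {k : ℕ} (α : E →L[ℝ] ℝ) (η ζ : E [⋀^Fin k]→L[ℝ] ℝ) :
    wedge α (η + ζ) = wedge α η + wedge α ζ := by
  ext v
  simp [wedge, ContinuousAlternatingMap.alternatizeUncurryFin_apply,
    Finset.sum_add_distrib]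

theorem wedge_smul {k : ℕ} (c : ℝ) (α : E →L[ℝ] ℝ) (η : E [⋀^Fin k]→L[ℝ] ℝ) :
    wedge α (c • η) = c • wedge α η := by
  ext v
  simp only [wedge, ContinuousAlternatingMap.alternatizeUncurryFin_apply, Finset.mul_sum,
    ContinuousLinearMap.smulRight_apply, ContinuousAlternatingMap.smul_apply, smul_eq_mul,
    Int.reduceNeg, zsmul_eq_mul]
  exact Finset.sum_congr rfl fun i _ => by ring

theorem add_wedge {k : ℕ} (α β : E →L[ℝ] ℝ) (η : E [⋀^Fin k]→L[ℝ] ℝ) :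
    wedge (α + β) η = wedge α η + wedge β η := by
  ext v
  simp [wedge, ContinuousAlternatingMap.alternatizeUncurryFin_apply, add_mul,
    Finset.sum_add_distrib]

theorem smul_wedge {k : ℕ} (c : ℝ) (α : E →L[ℝ] ℝ) (η : E [⋀^Fin k]→L[ℝ] ℝ) :
    wedge (c • α) η = c • wedge α η := by
  ext v
  simp only [wedge, ContinuousAlternatingMap.alternatizeUncurryFin_apply, Finset.mul_sum,
    ContinuousLinearMap.smulRight_apply, ContinuousAlternatingMap.smul_apply, smul_eq_mul,
    Int.reduceNeg, zsmul_eq_mul, smul_apply]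
  exact Finset.sum_congr rfl fun i _ => by ring

theorem contract_add {k : ℕ} (v : E) (η ζ : E [⋀^Fin (k + 1)]→L[ℝ] ℝ) :
    contract v (η + ζ) = contract v η + contract v ζ := rfl

theorem contract_smul {k : ℕ} (c : ℝ) (v : E) (η : E [⋀^Fin (k + 1)]→L[ℝ] ℝ) :
    contract v (c • η) = c • contract v η := rfl

theorem add_contract {k : ℕ} (v w : E) (η : E [⋀^Fin (k + 1)]→L[ℝ] ℝ) :
    contract (v + w) η = contract v η + contract w η := map_add η.curryLeft v w

theorem smul_contract {k : ℕ} (c : ℝ) (v : E) (η : E [⋀^Fin (k + 1)]→L[ℝ] ℝ) :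
    contract (c • v) η = c • contract v η := map_smul η.curryLeft c v

/-! ### The algebra of operators on differential forms -/

variable (E M)

/-- Families `η = (η_k)_k` of (not necessarily smooth) `k`-forms on `M`, `k = 0, 1, 2, …`. -/
def FormFamily : Type _ := Π k : ℕ, M → E [⋀^Fin k]→L[ℝ] ℝ

instance : AddCommGroup (FormFamily E M) :=
  inferInstanceAs (AddCommGroup (Π k : ℕ, M → E [⋀^Fin k]→L[ℝ] ℝ))

instance : Module ℝ (FormFamily E M) :=
  inferInstanceAs (Module ℝ (Π k : ℕ, M → E [⋀^Fin k]→L[ℝ] ℝ))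

/-- `Ω(M)`: smooth differential forms `η = (η_k)_k`, where `η_k` is the component of degree `k`
(it vanishes automatically when `k` exceeds the dimension of `M`). -/
def DiffForms : Submodule ℝ (FormFamily E M) where
  carrier := {η | ∀ k, IsSmoothForm (η k)}
  add_mem' h₁ h₂ k := (h₁ k).add (h₂ k)
  zero_mem' _ := IsSmoothForm.zero
  smul_mem' c _ h k := (h k).const_smul c

/-- Global sections of the sheaf `𝓔_M` of `ℝ`-linear endomorphisms of the sheaf `Ω_M`: the
`ℝ`-linear operators on `Ω(M)` which are local, i.e. `A η` vanishes on every open set on which `η`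
vanishes. -/
def opsSubalgebra : Subalgebra ℝ (Module.End ℝ (DiffForms E M)) where
  carrier := {A | ∀ U : Set M, IsOpen U → ∀ η : DiffForms E M,
    (∀ k, ∀ p ∈ U, η.1 k p = 0) → ∀ k, ∀ p ∈ U, (A η).1 k p = 0}
  mul_mem' hA hB U hU η hη := hA U hU _ (hB U hU η hη)
  one_mem' _ _ _ hη := hη
  add_mem' hA hB U hU η hη k p hp := by
    change (_ : E [⋀^Fin k]→L[ℝ] ℝ) + _ = 0
    rw [hA U hU η hη k p hp, hB U hU η hη k p hp, add_zero]
  zero_mem' _ _ _ _ _ _ _ := rfl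
  algebraMap_mem' c U _ η hη k p hp := by
    change c • (η.1 k p) = 0
    rw [hη k p hp, smul_zero]

/-- The algebra `𝓔(M)` of global sections of `𝓔_M`, as a type. -/
def Ops : Type _ := opsSubalgebra E M

instance : Ring (Ops E M) := inferInstanceAs (Ring (opsSubalgebra E M))

instance : Algebra ℝ (Ops E M) := inferInstanceAs (Algebra ℝ (opsSubalgebra E M))

/-- The constant function `1`, as a differential form. -/
def oneForm : DiffForms E M :=
  ⟨fun
    | 0 => fun _ => ContinuousAlternatingMap.constOfIsEmpty ℝ E (Fin 0) 1
    | _ + 1 => 0, fun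
    | 0 => IsSmoothForm.constZero 1
    | _ + 1 => IsSmoothForm.zero⟩

/-- The de Rham operator. -/
def deRham : Ops E M :=
  ⟨{  toFun η := ⟨fun
        | 0 => 0
        | k + 1 => extD (η.1 k), fun
        | 0 => IsSmoothForm.zero
        | k + 1 => (η.2 k).extD⟩
      map_add' η ζ := Subtype.ext <| funext fun
        | 0 => (add_zero _).symm
        | k + 1 => extD_add (η.2 k) (ζ.2 k)
      map_smul' c η := Subtype.ext <| funext fun
        | 0 => (smul_zero c).symm
        | k + 1 => extD_smul c (η.1 k) },
    fun _ hU _ hη k => match k with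
      | 0 => fun _ _ => rfl
      | k + 1 => extD_local hU (hη k)⟩

/-- The parity operator: multiplication by `(-1)^k` on forms of degree `k`. -/
def parity : Ops E M :=
  ⟨{  toFun η := ⟨fun k => ((-1 : ℝ) ^ k) • η.1 k, fun k => (η.2 k).const_smul _⟩
      map_add' η ζ := Subtype.ext <| funext fun k => smul_add _ _ _
      map_smul' c η := Subtype.ext <| funext fun k => smul_comm ((-1 : ℝ) ^ k) c (η.1 k) },
    fun U _ η hη k p hp => by
      change ((-1 : ℝ) ^ k) • η.1 k p = 0
      rw [hη k p hp, smul_zero]⟩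

/-- Smooth sections `p ↦ (X_p, α_p)` of the generalized tangent bundle `𝕋M = TM ⊕ T*M`. -/
def GTSection : Submodule ℝ (M → E × (E →L[ℝ] ℝ)) where
  carrier := {x | IsSmoothVector (fun p => (x p).1) ∧ IsSmoothCovector (fun p => (x p).2)}
  add_mem' h₁ h₂ := ⟨h₁.1.add h₂.1, h₁.2.add h₂.2⟩
  zero_mem' := ⟨IsSmoothVector.zero, IsSmoothCovector.zero⟩
  smul_mem' c _ h := ⟨h.1.const_smul c, h.2.const_smul c⟩

variable {E M}

/-- Multiplication by a smooth function; this identifies `Ω⁰` with a subalgebra of operators. -/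
def mulOp (f : C^∞⟮𝓘(ℝ, E), M; ℝ⟯) : Ops E M :=
  ⟨{  toFun η := ⟨fun k p => f p • η.1 k p, fun k => (η.2 k).smul f⟩
      map_add' η ζ := Subtype.ext <| funext fun k => funext fun p => smul_add _ _ _
      map_smul' c η := Subtype.ext <| funext fun k => funext fun p => smul_comm (f p) c (η.1 k p) },
    fun U _ η hη k p hp => by
      change f p • η.1 k p = 0
      rw [hη k p hp, smul_zero]⟩

/-- The form `ι_X η + α ∧ η`, degree by degree, for `x = (X, α)`. -/
def sectionFun (x : M → E × (E →L[ℝ] ℝ)) (η : FormFamily E M) : FormFamily E M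
  | 0 => fun p => contract (x p).1 (η 1 p)
  | k + 1 => fun p => contract (x p).1 (η (k + 2) p) + wedge (x p).2 (η k p)

/-- The action `η ↦ ι_X η + α ∧ η` of a section `(X, α)` of `𝕋M` on differential forms. -/
def sectionOp (x : GTSection E M) : Ops E M :=
  ⟨{  toFun η := ⟨sectionFun x.1 η.1, fun
        | 0 => (η.2 1).contract x.2.1
        | k + 1 => ((η.2 (k + 2)).contract x.2.1).add ((η.2 k).wedge x.2.2)⟩
      map_add' η ζ := Subtype.ext <| funext fun
        | 0 => funext fun p => contract_add _ _ _
        | k + 1 => funext fun p => by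
          change contract _ (η.1 (k + 2) p + ζ.1 (k + 2) p) + wedge _ (η.1 k p + ζ.1 k p) =
            (contract _ (η.1 (k + 2) p) + wedge _ (η.1 k p)) +
              (contract _ (ζ.1 (k + 2) p) + wedge _ (ζ.1 k p))
          rw [contract_add, wedge_add, add_add_add_comm]
      map_smul' c η := Subtype.ext <| funext fun
        | 0 => funext fun p => contract_smul _ _ _
        | k + 1 => funext fun p => by
          change contract _ (c • η.1 (k + 2) p) + wedge _ (c • η.1 k p) =
            c • (contract _ (η.1 (k + 2) p) + wedge _ (η.1 k p))
          rw [contract_smul, wedge_smul, smul_add] },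
    fun U _ η hη k p hp => match k with
      | 0 => by
        change contract (x.1 p).1 (η.1 1 p) = 0
        rw [hη 1 p hp, ← zero_smul ℝ (0 : E [⋀^Fin 1]→L[ℝ] ℝ), contract_smul, zero_smul]
      | k + 1 => by
        change contract (x.1 p).1 (η.1 (k + 2) p) + wedge (x.1 p).2 (η.1 k p) = 0
        rw [hη k p hp, hη (k + 2) p hp, ← zero_smul ℝ (0 : E [⋀^Fin (k + 2)]→L[ℝ] ℝ),
          ← zero_smul ℝ (0 : E [⋀^Fin k]→L[ℝ] ℝ), contract_smul, wedge_smul, zero_smul, zero_smul,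
          add_zero]⟩

theorem sectionOp_add (x y : GTSection E M) : sectionOp (x + y) = sectionOp x + sectionOp y :=
  Subtype.ext <| LinearMap.ext fun η => Subtype.ext <| funext fun
    | 0 => funext fun p => add_contract _ _ _
    | k + 1 => funext fun p => by
      change contract ((x.1 p).1 + (y.1 p).1) (η.1 (k + 2) p) +
          wedge ((x.1 p).2 + (y.1 p).2) (η.1 k p) =
        (contract (x.1 p).1 (η.1 (k + 2) p) + wedge (x.1 p).2 (η.1 k p)) +
          (contract (y.1 p).1 (η.1 (k + 2) p) + wedge (y.1 p).2 (η.1 k p))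
      rw [add_contract, add_wedge, add_add_add_comm]

theorem sectionOp_smul (c : ℝ) (x : GTSection E M) : sectionOp (c • x) = c • sectionOp x :=
  Subtype.ext <| LinearMap.ext fun η => Subtype.ext <| funext fun
    | 0 => funext fun p => smul_contract _ _ _
    | k + 1 => funext fun p => by
      change contract (c • (x.1 p).1) (η.1 (k + 2) p) + wedge (c • (x.1 p).2) (η.1 k p) =
        c • (contract (x.1 p).1 (η.1 (k + 2) p) + wedge (x.1 p).2 (η.1 k p))
      rw [smul_contract, smul_wedge, smul_add]

variable (E M)

/-- `𝕋M` inside the algebra of operators on differential forms. -/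
def GT : Submodule ℝ (Ops E M) :=
  LinearMap.range
    ({  toFun := sectionOp
        map_add' := sectionOp_add
        map_smul' := sectionOp_smul } : GTSection E M →ₗ[ℝ] Ops E M)

variable {E M}

/-! ### Graded commutators and derived brackets -/

/-- The part of an operator preserving the parity of the degree of forms. -/
def evenPart (A : Ops E M) : Ops E M := (1 / 2 : ℝ) • (A + parity E M * A * parity E M)

/-- The part of an operator reversing the parity of the degree of forms. -/
def oddPart (A : Ops E M) : Ops E M := (1 / 2 : ℝ) • (A - parity E M * A * parity E M)

/-- The graded commutator: the bilinear operation with `[A, B] = A B - (-1)^{kl} B A` for `A` of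
degree `k` and `B` of degree `l`. -/
def gcomm (A B : Ops E M) : Ops E M :=
  A * B - (evenPart B * evenPart A + evenPart B * oddPart A + oddPart B * evenPart A
    - oddPart B * oddPart A)

/-- The adjoint action `ad_A = [A, ·]`. -/
def ad (A : Ops E M) : Module.End ℝ (Ops E M) where
  toFun := gcomm A
  map_add' B C := by
    have h₀ : evenPart (B + C) = evenPart B + evenPart C := by
      simp only [evenPart, ← smul_add]; congr 1; noncomm_ring
    have h₁ : oddPart (B + C) = oddPart B + oddPart C := by
      simp only [oddPart, ← smul_add]; congr 1; noncomm_ring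
    simp only [gcomm, h₀, h₁]; noncomm_ring
  map_smul' c B := by
    have h₀ : evenPart (c • B) = c • evenPart B := by
      simp only [evenPart, mul_smul_comm, smul_mul_assoc, ← smul_add, smul_comm c]
    have h₁ : oddPart (c • B) = c • oddPart B := by
      simp only [oddPart, mul_smul_comm, smul_mul_assoc, ← smul_sub, smul_comm c]
    simp only [gcomm, h₀, h₁, mul_smul_comm, smul_mul_assoc, ← smul_sub, ← smul_add,
      RingHom.id_apply]

/-- The derived bracket `[[A, B]]_δ = [[A, δ], B]`; for `δ = d` it is the Dorfman bracket. -/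
def derivedBracket (δ A B : Ops E M) : Ops E M := gcomm (gcomm A δ) B

/-! ### Generalized polynomial structures -/

/-- The tautological inner product on the fibres of `𝕋M`: `⟨X + α, Y + β⟩ = (α(Y) + β(X)) / 2`. -/
def pairing (u v : E × (E →L[ℝ] ℝ)) : ℝ := (u.2 v.1 + v.2 u.1) / 2

variable (E M)

/-- Skew-symmetric (smooth) bundle endomorphisms of `𝕋M`, given on the fibres. -/
structure SkewEndo where
  /-- The endomorphism of the fibre of `𝕋M` at `p`. -/
  fiber : M → Module.End ℝ (E × (E →L[ℝ] ℝ))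
  smooth : ∀ x ∈ GTSection E M, (fun p => fiber p (x p)) ∈ GTSection E M
  skew : ∀ p u v, pairing (fiber p u) v + pairing u (fiber p v) = 0

variable {E M}

namespace SkewEndo

variable (φ : SkewEndo E M)

/-- The action of the endomorphism on smooth sections of `𝕋M`. -/
def onSections (x : GTSection E M) : GTSection E M := ⟨fun p => φ.fiber p (x.1 p), φ.smooth _ x.2⟩

/-- `φ` is a generalized polynomial structure with minimal polynomial `P`: the degree is positive
and `P` is the minimal polynomial of `φ` at every point. -/
def IsPolynomialStructure (P : Polynomial ℝ) : Prop :=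
  P.Monic ∧ 0 < P.natDegree ∧ ∀ p, minpoly ℝ (φ.fiber p) = P

/-- The spectrum of `φ`: the eigenvalues of `φ` acting on the fibres of `𝕋M ⊗ ℂ`. -/
def spectrum : Set ℂ :=
  {μ | ∃ p, Module.End.HasEigenvalue ((φ.fiber p).baseChange ℂ) μ}

/-- `T` is the lift of `φ` to an even operator on forms, normalized so that `T(1)` is a `2`-form. -/
structure IsLift (T : Ops E M) : Prop where
  even : oddPart T = 0
  functions : ∀ f : C^∞⟮𝓘(ℝ, E), M; ℝ⟯, gcomm T (mulOp f) = 0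
  sections : ∀ x : GTSection E M, gcomm T (sectionOp x) = sectionOp (φ.onSections x)
  normalized : ∀ k, k ≠ 2 → (T.1 (oneForm E M)).1 k = 0

end SkewEndo

/-- The minimal operator `P(ad_T)(d)`. -/
def minimalOperator (T : Ops E M) (P : Polynomial ℝ) : Ops E M :=
  Polynomial.aeval (ad T) P (deRham E M)

/-- The minimal torsion: the derived bracket of sections of `𝕋M` with respect to the minimal
operator. -/
def minimalTorsion (T : Ops E M) (P : Polynomial ℝ) (x y : GTSection E M) : Ops E M :=
  derivedBracket (minimalOperator T P) (sectionOp x) (sectionOp y)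

/-- A generalized polynomial structure with lift `T` and minimal polynomial `P` is minimal if its
minimal torsion vanishes. -/
def IsMinimal (T : Ops E M) (P : Polynomial ℝ) : Prop :=
  ∀ x y : GTSection E M, minimalTorsion T P x y = 0

/-! ### Complexification -/

/-- The adjoint action of `T` on `𝓔_M ⊗ ℂ`. -/
def adC (T : Ops E M) : Module.End ℂ (ℂ ⊗[ℝ] Ops E M) := (ad T).baseChange ℂ

variable (E M)

/-- The de Rham operator in `𝓔_M ⊗ ℂ`. -/
def deRhamC : ℂ ⊗[ℝ] Ops E M := 1 ⊗ₜ deRham E M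

/-- `𝕋M ⊗ ℂ` inside `𝓔_M ⊗ ℂ`. -/
def GTC : Submodule ℂ (ℂ ⊗[ℝ] Ops E M) := (GT E M).baseChange ℂ

variable {E M}

/-- The component of the de Rham operator `∑_{i=1}^{m} a_i Q_i(ad_T)(d)`, where `Q_i` is the
polynomial such that `(x - μ)^i Q_i(x) = P(x)`. -/
def deRhamComponent (T : Ops E M) (P : Polynomial ℝ) (μ : ℂ) (m : ℕ) (a : ℕ → ℂ) :
    ℂ ⊗[ℝ] Ops E M :=
  ∑ i ∈ Finset.Icc 1 m, a i • Polynomial.aeval (adC T)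
    (P.map (algebraMap ℝ ℂ) /ₘ (Polynomial.X - Polynomial.C μ) ^ i) (deRhamC E M)

/-- `a` are the coefficients of the partial fraction decomposition
`1 / P(x) = ∑_{μ ∈ S} ∑_{i=1}^{m(μ)} a_{μ,i} / (x - μ)^i`. -/
def IsPartialFraction (P : Polynomial ℝ) (S : Finset ℂ) (m : ℂ → ℕ) (a : ℂ → ℕ → ℂ) : Prop :=
  (algebraMap (Polynomial ℂ) (RatFunc ℂ) (P.map (algebraMap ℝ ℂ)))⁻¹ =
    ∑ μ ∈ S, ∑ i ∈ Finset.Icc 1 (m μ), RatFunc.C (a μ i) / (RatFunc.X - RatFunc.C μ) ^ i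

end Local

end GenGeom

end

/-!
Sections of `𝕋M` generate a Clifford algebra inside the operators on forms: `x y + y x = 2 ⟨x, y⟩`
(`sectionOp_mul_add`). Two facts about this action carry the proof.

*The lift.* On a fibre, a skew endomorphism is the commutator with a quadratic element of the
Clifford algebra. Written in normal order (contractions to the right of wedge products), this
element maps `1` to a `2`-form, see `cliffordLift_commutator` and `cliffordLift_apply_of_scalar`. It
does not depend on the frame used to write it down (`cliffordLift_eq`), so that these elements at
all points of `M` form a smooth operator (`isLift_lift`). Conversely, an operator which commutes, or
anticommutes, with all sections is determined by its value at `1`, because by Euler's identity every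
form is locally obtained from `1` by the action of sections (`eq_zero_of_supercommute`). The lift is
therefore unique.

*Minimality.* Let `δ = P(ad_T)(d)`, an odd operator. If `[[x, δ], y] = 0` for all sections, then
`[x, δ]` commutes with all sections, so it is multiplication by a function. From
`2 [⟨x, y⟩, δ] = [[x, y], δ]` it follows that `δ` commutes with functions, hence that `[x, δ]` is
linear in `x` over functions, `[x, δ] = 2 ⟨z, x⟩` for a section `z`. Now `δ - z` anticommutes with
all sections, so it maps `1` to a function (`apply_oneForm_succ`), which is zero because `δ - z` is
odd. Hence `δ = z`. Thus `φ` is minimal if and only if `δ` is a section of `𝕋M`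
(`mem_GT_iff_derivedBracket`, `SkewEndo.IsLift.isMinimal_iff`).

The rest is algebra of polynomials in `ad_T`, which maps sections of `𝕋M` to sections because
`[T, x] = φ(x)`. The partial fraction decomposition of `1 / P` is the identity
`1 = ∑ a_{μ,i} Q_{μ,i}`, which gives `d = ∑ d_μ`. Since `(x - μ)^{m(μ)} Q_{μ,i}` is a multiple of
`P`, if `δ` is a section then so is `(ad_T - μ)^{m(μ)} d_μ`. Conversely, `P` is a multiple of each
`(x - μ)^{m(μ)}`, so any decomposition of `d` as in the theorem makes `δ` a section of `𝕋M ⊗ ℂ`, and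
`δ` is real.
-/

noncomputable section

namespace GenGeom

/-! ### The Clifford action on a fibre -/

section Fibre

variable {E : Type*} [NormedAddCommGroup E] [NormedSpace ℝ E]

theorem contract_contract_add {k : ℕ} (v w : E) (η : E [⋀^Fin (k + 2)]→L[ℝ] ℝ) :
    contract v (contract w η) + contract w (contract v η) = 0 := by
  have h : ∀ u : E, contract u (contract u η) = 0 := fun u => by
    ext a
    exact η.map_eq_zero_of_eq _ (i := 0) (j := 1) rfl (by simp)
  have h1 := h (v + w)
  rw [add_contract, add_contract, contract_add, contract_add, h v, h w] at h1
  simpa [add_comm] using h1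

open ContinuousAlternatingMap in
theorem wedge_wedge_self {k : ℕ} (α : E →L[ℝ] ℝ) (η : E [⋀^Fin k]→L[ℝ] ℝ) :
    wedge α (wedge α η) = 0 := by
  have h := alternatizeUncurryFin_alternatizeUncurryFinCLM_comp_of_symmetric
    (𝕜 := ℝ) (E := E) (F := ℝ) (n := k) (f := α.smulRight (α.smulRight η)) (fun x y => by
      simp [smul_smul, mul_comm])
  rw [← h, wedge]
  congr 1
  ext v : 1
  simp only [ContinuousLinearMap.smulRight_apply, ContinuousLinearMap.comp_apply, map_smul]
  rfl

theorem wedge_wedge_add {k : ℕ} (α β : E →L[ℝ] ℝ) (η : E [⋀^Fin k]→L[ℝ] ℝ) :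
    wedge α (wedge β η) + wedge β (wedge α η) = 0 := by
  have h1 := wedge_wedge_self (α + β) η
  rw [add_wedge, add_wedge, wedge_add, wedge_add, wedge_wedge_self, wedge_wedge_self] at h1
  simpa [add_comm] using h1

theorem contract_wedge_zero (v : E) (α : E →L[ℝ] ℝ) (η : E [⋀^Fin 0]→L[ℝ] ℝ) :
    contract v (wedge α η) = α v • η := by
  ext a
  simp only [contract, wedge, ContinuousAlternatingMap.curryLeft_apply_apply,
    ContinuousAlternatingMap.alternatizeUncurryFin_apply]
  simp

theorem contract_wedge_succ {k : ℕ} (v : E) (α : E →L[ℝ] ℝ) (η : E [⋀^Fin (k + 1)]→L[ℝ] ℝ) :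
    contract v (wedge α η) + wedge α (contract v η) = α v • η := by
  ext a
  simp only [contract, wedge, ContinuousAlternatingMap.curryLeft_apply_apply,
    ContinuousAlternatingMap.alternatizeUncurryFin_apply, ContinuousAlternatingMap.add_apply]
  rw [Fin.sum_univ_succ]
  have h : ∀ j : Fin (k + 1), (Fin.succ j).removeNth (Matrix.vecCons v a : Fin (k + 2) → E) =
      Matrix.vecCons v (j.removeNth a) := fun j => by
    funext i
    refine Fin.cases ?_ (fun i => ?_) i <;> simp [Fin.removeNth, Matrix.vecCons]
  simp [h, pow_succ, add_assoc]

/-- The exterior algebra of a fibre: `k`-forms, one for every `k`. -/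
def Fib (E : Type*) [NormedAddCommGroup E] [NormedSpace ℝ E] : Type _ :=
  (k : ℕ) → E [⋀^Fin k]→L[ℝ] ℝ

instance : AddCommGroup (Fib E) :=
  inferInstanceAs (AddCommGroup ((k : ℕ) → E [⋀^Fin k]→L[ℝ] ℝ))

instance : Module ℝ (Fib E) :=
  inferInstanceAs (Module ℝ ((k : ℕ) → E [⋀^Fin k]→L[ℝ] ℝ))

/-- The component of degree `k`. -/
def Fib.proj (k : ℕ) : Fib E →ₗ[ℝ] E [⋀^Fin k]→L[ℝ] ℝ where
  toFun θ := θ k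
  map_add' _ _ := rfl
  map_smul' _ _ := rfl

theorem Fib.sum_apply {ι : Type*} (s : Finset ι) (θ : ι → Fib E) (k : ℕ) :
    (∑ i ∈ s, θ i) k = ∑ i ∈ s, θ i k := map_sum (Fib.proj k) θ s

/-- The Clifford action `η ↦ ι_v η + α ∧ η` of `(v, α)` on the exterior algebra of a fibre. -/
def clifford : E × (E →L[ℝ] ℝ) →ₗ[ℝ] Module.End ℝ (Fib E) where
  toFun u :=
    { toFun θ
        | 0 => contract u.1 (θ 1)
        | k + 1 => contract u.1 (θ (k + 2)) + wedge u.2 (θ k)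
      map_add' θ ζ := funext fun
        | 0 => contract_add _ _ _
        | k + 1 => by
          change contract _ (θ (k + 2) + ζ (k + 2)) + wedge _ (θ k + ζ k) =
            (contract _ (θ (k + 2)) + wedge _ (θ k)) + (contract _ (ζ (k + 2)) + wedge _ (ζ k))
          rw [contract_add, wedge_add, add_add_add_comm]
      map_smul' c θ := funext fun
        | 0 => contract_smul _ _ _
        | k + 1 => by
          change contract _ (c • θ (k + 2)) + wedge _ (c • θ k) =
            c • (contract _ (θ (k + 2)) + wedge _ (θ k))
          rw [contract_smul, wedge_smul, smul_add] }
  map_add' u v := LinearMap.ext fun θ => funext fun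
    | 0 => add_contract _ _ _
    | k + 1 => by
      change contract (u.1 + v.1) _ + wedge (u.2 + v.2) _ =
        (contract u.1 (θ (k + 2)) + wedge u.2 (θ k)) + (contract v.1 (θ (k + 2)) + wedge v.2 (θ k))
      rw [add_contract, add_wedge, add_add_add_comm]
  map_smul' c u := LinearMap.ext fun θ => funext fun
    | 0 => smul_contract _ _ _
    | k + 1 => by
      change contract (c • u.1) _ + wedge (c • u.2) _ =
        c • (contract u.1 (θ (k + 2)) + wedge u.2 (θ k))
      rw [smul_contract, smul_wedge, smul_add]

theorem clifford_apply_zero (u : E × (E →L[ℝ] ℝ)) (θ : Fib E) :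
    clifford u θ 0 = contract u.1 (θ 1) := rfl

theorem clifford_apply_succ (u : E × (E →L[ℝ] ℝ)) (θ : Fib E) (k : ℕ) :
    clifford u θ (k + 1) = contract u.1 (θ (k + 2)) + wedge u.2 (θ k) := rfl

/-- The Clifford relation `u v + v u = 2 ⟨u, v⟩`. -/
theorem clifford_mul_add (u v : E × (E →L[ℝ] ℝ)) :
    clifford u * clifford v + clifford v * clifford u = (2 * pairing u v) • 1 := by
  have e : 2 * pairing u v = u.2 v.1 + v.2 u.1 := by simp only [pairing]; ring
  rw [e]
  refine LinearMap.ext fun θ => funext fun k => ?_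
  change clifford u (clifford v θ) k + clifford v (clifford u θ) k = (u.2 v.1 + v.2 u.1) • θ k
  match k with
  | 0 =>
    simp only [clifford_apply_zero, clifford_apply_succ, contract_add, contract_wedge_zero]
    rw [add_add_add_comm, contract_contract_add, zero_add, ← add_smul, add_comm]
  | 1 =>
    simp only [clifford_apply_zero, clifford_apply_succ, contract_add]
    have h1 := contract_contract_add u.1 v.1 (θ 3)
    have h2 := contract_wedge_succ u.1 v.2 (θ 1)
    have h3 := contract_wedge_succ v.1 u.2 (θ 1)
    linear_combination (norm := module) h1 + h2 + h3
  | k + 2 =>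
    simp only [clifford_apply_succ, contract_add, wedge_add]
    have h1 := contract_contract_add u.1 v.1 (θ (k + 4))
    have h2 := contract_wedge_succ u.1 v.2 (θ (k + 2))
    have h3 := contract_wedge_succ v.1 u.2 (θ (k + 2))
    have h4 := wedge_wedge_add u.2 v.2 (θ k)
    linear_combination (norm := module) h1 + h2 + h3 + h4

/-- The parity operator on the exterior algebra of a fibre. -/
def fibParity : Module.End ℝ (Fib E) where
  toFun θ k := ((-1 : ℝ) ^ k) • θ k
  map_add' _ _ := funext fun _ => smul_add _ _ _
  map_smul' c θ := funext fun k => smul_comm ((-1 : ℝ) ^ k) c (θ k)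

theorem fibParity_mul_self : (fibParity : Module.End ℝ (Fib E)) * fibParity = 1 :=
  LinearMap.ext fun θ => funext fun k => by
    change ((-1 : ℝ) ^ k) • ((-1 : ℝ) ^ k) • θ k = θ k
    rw [smul_smul, ← mul_pow]; simp

theorem fibParity_mul_clifford_add (u : E × (E →L[ℝ] ℝ)) :
    fibParity * clifford u + clifford u * fibParity = 0 :=
  LinearMap.ext fun θ => funext fun
    | 0 => by
      change ((-1 : ℝ) ^ 0) • contract u.1 (θ 1) + contract u.1 (((-1 : ℝ) ^ 1) • θ 1) = 0
      rw [contract_smul]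
      module
    | k + 1 => by
      change ((-1 : ℝ) ^ (k + 1)) • (contract u.1 (θ (k + 2)) + wedge u.2 (θ k)) +
        (contract u.1 (((-1 : ℝ) ^ (k + 2)) • θ (k + 2)) + wedge u.2 (((-1 : ℝ) ^ k) • θ k)) = 0
      rw [contract_smul, wedge_smul, pow_succ, pow_succ, pow_succ]
      module

theorem fibParity_mul_clifford_mul (u v : E × (E →L[ℝ] ℝ)) :
    fibParity * (clifford u * clifford v) = clifford u * clifford v * fibParity := by
  rw [← sub_eq_zero]
  have e : fibParity * (clifford u * clifford v) - clifford u * clifford v * fibParity =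
      (fibParity * clifford u + clifford u * fibParity) * clifford v -
        clifford u * (fibParity * clifford v + clifford v * fibParity) := by noncomm_ring
  rw [e, fibParity_mul_clifford_add, fibParity_mul_clifford_add, zero_mul, mul_zero, sub_zero]

/-! ### The Clifford lift of a skew endomorphism of a fibre -/

section Lift

variable {ι : Type*} [Fintype ι]

/-- The families `γ` of covectors and `w` of vectors satisfy `∑ i, γ_i ⊗ w_i = id`. -/
def IsResolution (γ : ι → E →L[ℝ] ℝ) (w : ι → E) : Prop := ∀ v, ∑ i, γ i v • w i = v

theorem IsResolution.dual {γ : ι → E →L[ℝ] ℝ} {w : ι → E} (h : IsResolution γ w)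
    (α : E →L[ℝ] ℝ) : ∑ i, α (w i) • γ i = α := by
  ext v
  conv_rhs => rw [← h v, map_sum]
  simp [sum_apply, mul_comm]

/-- A bilinear expression in `∑ i, γ_i ⊗ w_i = id` does not depend on the resolution. -/
theorem IsResolution.sum_eq {κ V : Type*} [Fintype κ] [AddCommGroup V] [Module ℝ V]
    {γ : ι → E →L[ℝ] ℝ} {w : ι → E} (h : IsResolution γ w)
    {γ' : κ → E →L[ℝ] ℝ} {w' : κ → E} (h' : IsResolution γ' w')
    (F : (E →L[ℝ] ℝ) →ₗ[ℝ] E →ₗ[ℝ] V) : ∑ i, F (γ i) (w i) = ∑ j, F (γ' j) (w' j) := by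
  have h1 : ∀ i, F (γ i) (w i) = ∑ j, F (γ' j) (γ i (w' j) • w i) := fun i => by
    conv_lhs => rw [← h'.dual (γ i)]
    simp only [map_sum, map_smul, LinearMap.sum_apply, LinearMap.smul_apply]
  simp only [h1]
  rw [Finset.sum_comm]
  refine Finset.sum_congr rfl fun j _ => ?_
  rw [← map_sum, h]

/-- Euler's identity: `∑ i, γ_i ∧ ι_{w_i}` is multiplication by the degree. -/
theorem IsResolution.sum_wedge_contract {γ : ι → E →L[ℝ] ℝ} {w : ι → E} (h : IsResolution γ w)
    {k : ℕ} (η : E [⋀^Fin (k + 1)]→L[ℝ] ℝ) :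
    ∑ i, wedge (γ i) (contract (w i) η) = ((k : ℝ) + 1) • η := by
  have h1 : η.curryLeft = ∑ i, (γ i).smulRight (η.curryLeft (w i)) := by
    ext1 v
    conv_lhs => rw [← h v]
    simp only [map_sum, map_smul, sum_apply,
      ContinuousLinearMap.smulRight_apply]
  have h2 := ContinuousAlternatingMap.alternatizeUncurryFin_curryLeft η
  rw [h1, ← ContinuousAlternatingMap.alternatizeUncurryFinCLM_apply, map_sum] at h2
  refine Eq.trans h2 ?_
  rw [← Nat.cast_smul_eq_nsmul ℝ]
  push_cast; rfl

/-- The normally ordered element of the Clifford algebra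
`∑ i, (ψ γ_i)_{T*} w_i - ½ γ_i (ψ w_i)_{T*} - ½ w_i (ψ γ_i)_T` representing a skew endomorphism
`ψ`, where `∑ i, γ_i ⊗ w_i = id`. -/
def cliffordLift (ψ : Module.End ℝ (E × (E →L[ℝ] ℝ))) (γ : ι → E →L[ℝ] ℝ) (w : ι → E) :
    Module.End ℝ (Fib E) :=
  ∑ i, (clifford (0, (ψ (0, γ i)).2) * clifford (w i, 0) -
    (1 / 2 : ℝ) • (clifford (0, γ i) * clifford (0, (ψ (w i, 0)).2)) -
    (1 / 2 : ℝ) • (clifford (w i, 0) * clifford ((ψ (0, γ i)).1, 0)))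

theorem cliffordLift_eq {κ : Type*} [Fintype κ] (ψ : Module.End ℝ (E × (E →L[ℝ] ℝ)))
    {γ : ι → E →L[ℝ] ℝ} {w : ι → E} (h : IsResolution γ w)
    {γ' : κ → E →L[ℝ] ℝ} {w' : κ → E} (h' : IsResolution γ' w') :
    cliffordLift ψ γ w = cliffordLift ψ γ' w' := by
  let a : (E →L[ℝ] ℝ) →ₗ[ℝ] Module.End ℝ (Fib E) := clifford ∘ₗ LinearMap.inr ℝ _ _
  let c : E →ₗ[ℝ] Module.End ℝ (Fib E) := clifford ∘ₗ LinearMap.inl ℝ _ _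
  let p := LinearMap.snd ℝ E (E →L[ℝ] ℝ) ∘ₗ ψ
  let q := LinearMap.fst ℝ E (E →L[ℝ] ℝ) ∘ₗ ψ
  let m := LinearMap.mul ℝ (Module.End ℝ (Fib E))
  exact h.sum_eq h' (m.compl₁₂ (a ∘ₗ p ∘ₗ LinearMap.inr ℝ _ _) c -
    (1 / 2 : ℝ) • m.compl₁₂ a (a ∘ₗ p ∘ₗ LinearMap.inl ℝ _ _) -
    (1 / 2 : ℝ) • (m.compl₁₂ c (c ∘ₗ q ∘ₗ LinearMap.inr ℝ _ _)).flip)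

theorem fibParity_mul_cliffordLift (ψ : Module.End ℝ (E × (E →L[ℝ] ℝ))) (γ : ι → E →L[ℝ] ℝ)
    (w : ι → E) : fibParity * cliffordLift ψ γ w = cliffordLift ψ γ w * fibParity := by
  simp only [cliffordLift, Finset.mul_sum, Finset.sum_mul, mul_sub, sub_mul, mul_smul_comm,
    smul_mul_assoc, fibParity_mul_clifford_mul]

theorem wedge_zero {k : ℕ} (α : E →L[ℝ] ℝ) : wedge α (0 : E [⋀^Fin k]→L[ℝ] ℝ) = 0 := by
  rw [← zero_smul ℝ (0 : E [⋀^Fin k]→L[ℝ] ℝ), wedge_smul, zero_smul]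

theorem contract_zero {k : ℕ} (v : E) : contract v (0 : E [⋀^Fin (k + 1)]→L[ℝ] ℝ) = 0 := rfl

theorem zero_wedge {k : ℕ} (η : E [⋀^Fin k]→L[ℝ] ℝ) : wedge 0 η = 0 := by
  rw [← zero_smul ℝ (0 : E →L[ℝ] ℝ), smul_wedge, zero_smul]

theorem zero_contract {k : ℕ} (η : E [⋀^Fin (k + 1)]→L[ℝ] ℝ) : contract 0 η = 0 := by
  rw [← zero_smul ℝ (0 : E), smul_contract, zero_smul]

theorem clifford_vector_apply (v : E) (θ : Fib E) (k : ℕ) :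
    clifford (v, 0) θ k = contract v (θ (k + 1)) := by
  match k with
  | 0 => rfl
  | k + 1 =>
    change contract v (θ (k + 2)) + wedge 0 (θ k) = contract v (θ (k + 2))
    rw [zero_wedge, add_zero]

theorem clifford_covector_apply_zero (α : E →L[ℝ] ℝ) (θ : Fib E) : clifford (0, α) θ 0 = 0 :=
  zero_contract _

theorem clifford_covector_apply_succ (α : E →L[ℝ] ℝ) (θ : Fib E) (k : ℕ) :
    clifford (0, α) θ (k + 1) = wedge α (θ k) := by
  change contract 0 (θ (k + 2)) + wedge α (θ k) = wedge α (θ k)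
  rw [zero_contract, zero_add]

/-- The Clifford lift maps scalars to `2`-forms: this is what normal ordering achieves. -/
theorem cliffordLift_apply_of_scalar (ψ : Module.End ℝ (E × (E →L[ℝ] ℝ))) (γ : ι → E →L[ℝ] ℝ)
    (w : ι → E) {θ : Fib E} (hθ : ∀ k, θ (k + 1) = 0) {k : ℕ} (hk : k ≠ 2) :
    cliffordLift ψ γ w θ k = 0 := by
  have hv : ∀ v : E, clifford (v, 0) θ = 0 := fun v => funext fun k => by
    rw [clifford_vector_apply, hθ, contract_zero]; rfl
  have hc : ∀ α β : E →L[ℝ] ℝ, clifford (0, α) (clifford (0, β) θ) k = 0 := fun α β => by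
    match k with
    | 0 => rw [clifford_covector_apply_zero]
    | 1 => rw [clifford_covector_apply_succ, clifford_covector_apply_zero, wedge_zero]
    | 2 => exact absurd rfl hk
    | k + 3 =>
      rw [clifford_covector_apply_succ, clifford_covector_apply_succ, hθ, wedge_zero, wedge_zero]
  have he : cliffordLift ψ γ w θ = ∑ i, (-(1 / 2 : ℝ)) •
      clifford (0, γ i) (clifford (0, (ψ (w i, 0)).2) θ) := by
    rw [cliffordLift, LinearMap.sum_apply]
    refine Finset.sum_congr rfl fun i _ => ?_
    simp only [LinearMap.sub_apply, LinearMap.smul_apply, Module.End.mul_apply, hv, map_zero,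
      smul_zero]
    module
  rw [he, Fib.sum_apply]
  refine Finset.sum_eq_zero fun i _ => ?_
  change (-(1 / 2 : ℝ)) • clifford (0, γ i) (clifford (0, (ψ (w i, 0)).2) θ) k = 0
  rw [hc, smul_zero]

theorem clifford_mul_commutator (x y z : E × (E →L[ℝ] ℝ)) :
    clifford x * clifford y * clifford z - clifford z * (clifford x * clifford y) =
      clifford ((2 * pairing y z) • x - (2 * pairing x z) • y) := by
  have h1 := clifford_mul_add y z
  have h2 := clifford_mul_add x z
  have e : clifford x * clifford y * clifford z - clifford z * (clifford x * clifford y) =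
      clifford x * (clifford y * clifford z + clifford z * clifford y) -
      (clifford x * clifford z + clifford z * clifford x) * clifford y := by noncomm_ring
  rw [e, h1, h2]
  simp

/-- The commutator with the Clifford lift of a skew endomorphism `ψ` acts by `ψ`. -/
theorem cliffordLift_commutator {ψ : Module.End ℝ (E × (E →L[ℝ] ℝ))}
    (hψ : ∀ u v, pairing (ψ u) v + pairing u (ψ v) = 0)
    {γ : ι → E →L[ℝ] ℝ} {w : ι → E} (h : IsResolution γ w) (z : E × (E →L[ℝ] ℝ)) :
    cliffordLift ψ γ w * clifford z - clifford z * cliffordLift ψ γ w = clifford (ψ z) := by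
  have e : cliffordLift ψ γ w * clifford z - clifford z * cliffordLift ψ γ w =
      clifford (∑ i, (((2 * pairing (w i, 0) z) • ((0, (ψ (0, γ i)).2) : E × (E →L[ℝ] ℝ)) -
          (2 * pairing (0, (ψ (0, γ i)).2) z) • (w i, 0)) -
        (1 / 2 : ℝ) • ((2 * pairing (0, (ψ (w i, 0)).2) z) • (0, γ i) -
          (2 * pairing (0, γ i) z) • (0, (ψ (w i, 0)).2)) -
        (1 / 2 : ℝ) • ((2 * pairing ((ψ (0, γ i)).1, 0) z) • (w i, 0) -
          (2 * pairing (w i, 0) z) • ((ψ (0, γ i)).1, 0)))) := by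
    rw [map_sum, cliffordLift, Finset.sum_mul, Finset.mul_sum, ← Finset.sum_sub_distrib]
    refine Finset.sum_congr rfl fun i _ => ?_
    rw [map_sub, map_sub, map_smul, map_smul, ← clifford_mul_commutator,
      ← clifford_mul_commutator, ← clifford_mul_commutator]
    simp only [sub_mul, mul_sub, smul_mul_assoc, mul_smul_comm, smul_sub]
    abel
  rw [e]
  congr 1
  obtain ⟨v, α⟩ := z
  have p2 : ∀ a b c d, 2 * pairing ((a, b) : E × (E →L[ℝ] ℝ)) (c, d) = b c + d a :=
    fun a b c d => by simp only [pairing]; ring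
  have hα : ψ (0, α) = ∑ i, α (w i) • ψ (0, γ i) := by
    have : ((0, α) : E × (E →L[ℝ] ℝ)) = ∑ i, α (w i) • (0, γ i) :=
      Prod.ext (by simp [Prod.fst_sum]) (by simp [Prod.snd_sum, h.dual])
    rw [this, map_sum]; simp only [map_smul]
  have hv : ψ (v, 0) = ∑ i, γ i v • ψ (w i, 0) := by
    have : ((v, 0) : E × (E →L[ℝ] ℝ)) = ∑ i, γ i v • (w i, 0) :=
      Prod.ext (by simp [Prod.fst_sum, h v]) (by simp [Prod.snd_sum])
    rw [this, map_sum]; simp only [map_smul]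
  have hz : ψ (v, α) = ψ (v, 0) + ψ (0, α) := by rw [← map_add]; simp
  have s1 : ∀ i, (ψ (0, γ i)).2 v = -γ i (ψ (v, 0)).1 := fun i => by
    have := hψ (0, γ i) (v, 0)
    simp only [pairing, map_zero, zero_apply] at this
    linarith
  have s2 : ∀ i, α (ψ (0, γ i)).1 = -γ i (ψ (0, α)).1 := fun i => by
    have := hψ (0, γ i) (0, α)
    simp only [pairing, map_zero] at this
    linarith
  have s3 : ∀ i, (ψ (w i, 0)).2 v = -(ψ (v, 0)).2 (w i) := fun i => by
    have := hψ (w i, 0) (v, 0)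
    simp only [pairing, zero_apply] at this
    linarith
  have r1 := h (ψ (v, 0)).1
  have r2 := h (ψ (0, α)).1
  have r3 : (∑ i, (-(ψ (v, 0)).2 (w i)) • ((0, γ i) : E × (E →L[ℝ] ℝ))).2 = -(ψ (v, 0)).2 := by
    rw [Prod.snd_sum, ← h.dual (-(ψ (v, 0)).2)]
    rfl
  have a1 := congrArg Prod.fst hα
  have a2 := congrArg Prod.snd hα
  have a3 := congrArg Prod.snd hv
  simp only [Prod.fst_sum, Prod.snd_sum, Prod.smul_fst, Prod.smul_snd] at a1 a2 a3 r3
  simp only [p2, s1, s2, s3, zero_apply, map_zero, zero_add, add_zero]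
  rw [hz]
  refine Prod.ext ?_ ?_
  · simp only [Prod.fst_sum, Prod.fst_sub, Prod.smul_fst, Prod.fst_add, smul_zero, neg_smul,
      Finset.sum_sub_distrib, Finset.sum_neg_distrib, ← Finset.smul_sum, r1, r2, ← a1,
      Finset.sum_const_zero]
    module
  · simp only [Prod.snd_sum, Prod.snd_sub, Prod.smul_snd, Prod.snd_add, smul_zero,
      Finset.sum_sub_distrib, ← Finset.smul_sum, r3, ← a2, ← a3,
      Finset.sum_const_zero]
    module

end Lift

end Fibre

section Frames

variable {E : Type*} [NormedAddCommGroup E] [NormedSpace ℝ E]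
  {M : Type*} [TopologicalSpace M] [ChartedSpace E M] [IsManifold 𝓘(ℝ, E) ∞ M]

/-! ### Smoothness is a local condition -/

theorem eventually_chart_symm {P : M → Prop} {x₀ : M} {y : E}
    (hy : y ∈ (extChartAt 𝓘(ℝ, E) x₀).target)
    (h : ∀ᶠ q in nhds ((extChartAt 𝓘(ℝ, E) x₀).symm y), P q) :
    ∀ᶠ z in nhds y, P ((extChartAt 𝓘(ℝ, E) x₀).symm z) :=
  (continuousAt_extChartAt_symm'' hy).eventually h

theorem IsSmoothForm.of_locally {k : ℕ} {η : M → E [⋀^Fin k]→L[ℝ] ℝ}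
    (h : ∀ p, ∃ ζ : M → E [⋀^Fin k]→L[ℝ] ℝ, IsSmoothForm ζ ∧ ∀ᶠ q in nhds p, η q = ζ q) :
    IsSmoothForm η := by
  intro x₀ y hy
  obtain ⟨ζ, hζ, he⟩ := h ((extChartAt 𝓘(ℝ, E) x₀).symm y)
  refine (((hζ x₀).contDiffAt ((isOpen_chart_target x₀).mem_nhds hy)).congr_of_eventuallyEq
    ?_).contDiffWithinAt
  filter_upwards [eventually_chart_symm hy he] with z hz
  simp only [chartForm, hz]

theorem IsSmoothCovector.of_locally {α : M → E →L[ℝ] ℝ}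
    (h : ∀ p, ∃ β : M → E →L[ℝ] ℝ, IsSmoothCovector β ∧ ∀ᶠ q in nhds p, α q = β q) :
    IsSmoothCovector α := by
  intro x₀ y hy
  obtain ⟨ζ, hζ, he⟩ := h ((extChartAt 𝓘(ℝ, E) x₀).symm y)
  refine (((hζ x₀).contDiffAt ((isOpen_chart_target x₀).mem_nhds hy)).congr_of_eventuallyEq
    ?_).contDiffWithinAt
  filter_upwards [eventually_chart_symm hy he] with z hz
  simp only [chartCovector, hz]

theorem IsSmoothVector.of_locally {X : M → E}
    (h : ∀ p, ∃ Y : M → E, IsSmoothVector Y ∧ ∀ᶠ q in nhds p, X q = Y q) :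
    IsSmoothVector X := by
  intro p
  obtain ⟨Y, hY, he⟩ := h p
  refine (hY p).congr_of_eventuallyEq ?_
  filter_upwards [he] with q hq
  rw [hq]

theorem mem_GTSection_of_locally {x : M → E × (E →L[ℝ] ℝ)}
    (h : ∀ p, ∃ y ∈ GTSection E M, ∀ᶠ q in nhds p, x q = y q) : x ∈ GTSection E M :=
  ⟨.of_locally fun p => by
      obtain ⟨y, hy, he⟩ := h p
      exact ⟨_, hy.1, he.mono fun q hq => congrArg Prod.fst hq⟩,
    .of_locally fun p => by
      obtain ⟨y, hy, he⟩ := h p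
      exact ⟨_, hy.2, he.mono fun q hq => congrArg Prod.snd hq⟩⟩

theorem contMDiff_of_chart {f : M → ℝ} (h : ∀ x₀ : M,
    ContDiffOn ℝ ∞ (f ∘ (extChartAt 𝓘(ℝ, E) x₀).symm) (extChartAt 𝓘(ℝ, E) x₀).target) :
    ContMDiff 𝓘(ℝ, E) 𝓘(ℝ, ℝ) ∞ f := by
  intro x₀
  have h1 := (contMDiffOn_iff_contDiffOn.2 (h x₀)).comp
    (contMDiffOn_extChartAt (I := 𝓘(ℝ, E)) (n := ∞) (x := x₀)) (fun q hq => by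
      rw [← extChartAt_source 𝓘(ℝ, E)] at hq
      exact (extChartAt 𝓘(ℝ, E) x₀).map_source hq)
  refine (h1.contMDiffAt ((chartAt E x₀).open_source.mem_nhds
    (mem_chart_source E x₀))).congr_of_eventuallyEq ?_
  filter_upwards [(chartAt E x₀).open_source.mem_nhds (mem_chart_source E x₀)] with q hq
  rw [← extChartAt_source 𝓘(ℝ, E)] at hq
  exact congrArg f ((extChartAt 𝓘(ℝ, E) x₀).left_inv hq).symm

/-- The smooth function underlying a smooth `0`-form. -/
def IsSmoothForm.toFunction {η : M → E [⋀^Fin 0]→L[ℝ] ℝ} (hη : IsSmoothForm η) :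
    C^∞⟮𝓘(ℝ, E), M; ℝ⟯ :=
  ⟨fun p => η p ![], contMDiff_of_chart fun x₀ => by
    have h :=
      (ContinuousAlternatingMap.apply ℝ E ℝ (![] : Fin 0 → E)).contDiff.comp_contDiffOn (hη x₀)
    refine h.congr fun y hy => ?_
    simp [chartForm]
    congr 1
    exact Subsingleton.elim _ _⟩

/-- The smooth function `α(X)` for a covector field `α` and a vector field `X`. -/
def evalFunction {α : M → E →L[ℝ] ℝ} {X : M → E} (hα : IsSmoothCovector α)
    (hX : IsSmoothVector X) : C^∞⟮𝓘(ℝ, E), M; ℝ⟯ :=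
  ⟨fun p => α p (X p), contMDiff_of_chart fun x₀ => by
    refine ((hα x₀).clm_apply (hX.chart x₀)).congr fun y hy => ?_
    have hq0 := mem_target_source hy
    simp only [chartCovector, Function.comp_apply, ContinuousLinearMap.comp_apply]
    rw [tangentCoordChange_comp ⟨⟨mem_extChartAt_source _, hq0⟩, mem_extChartAt_source _⟩,
      tangentCoordChange_self (mem_extChartAt_source _)]⟩

theorem IsSmoothVector.smul {X : M → E} (f : C^∞⟮𝓘(ℝ, E), M; ℝ⟯) (hX : IsSmoothVector X) :
    IsSmoothVector (fun p => f p • X p) :=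
  ContMDiff.smul_section (V := (TangentSpace 𝓘(ℝ, E) : M → Type _)) f.contMDiff hX

theorem contDiffOn_function_chart (f : C^∞⟮𝓘(ℝ, E), M; ℝ⟯) (x₀ : M) :
    ContDiffOn ℝ ∞ (f ∘ (extChartAt 𝓘(ℝ, E) x₀).symm) (extChartAt 𝓘(ℝ, E) x₀).target :=
  contMDiffOn_iff_contDiffOn.1
    (f.contMDiff.comp_contMDiffOn (contMDiffOn_extChartAt_symm (I := 𝓘(ℝ, E)) (n := ∞) x₀))

theorem IsSmoothCovector.smul {α : M → E →L[ℝ] ℝ} (f : C^∞⟮𝓘(ℝ, E), M; ℝ⟯)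
    (hα : IsSmoothCovector α) : IsSmoothCovector (fun p => f p • α p) := fun x₀ =>
  ((contDiffOn_function_chart f x₀).smul (hα x₀)).congr fun y _ => by
    ext v; simp [chartCovector]

/-- The product of a smooth function and a section of `𝕋M`. -/
def funSmul (f : C^∞⟮𝓘(ℝ, E), M; ℝ⟯) (x : GTSection E M) : GTSection E M :=
  ⟨fun p => f p • x.1 p, x.2.1.smul f, x.2.2.smul f⟩

/-- The smooth function `2 ⟨x, y⟩`. -/
def pairingFunction (x y : GTSection E M) : C^∞⟮𝓘(ℝ, E), M; ℝ⟯ :=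
  evalFunction x.2.2 y.2.1 + evalFunction y.2.2 x.2.1

theorem pairingFunction_apply (x y : GTSection E M) (p : M) :
    pairingFunction x y p = 2 * pairing (x.1 p) (y.1 p) := by
  change (x.1 p).2 (y.1 p).1 + (y.1 p).2 (x.1 p).1 = _
  simp only [pairing]; ring

/-! ### Local frames -/

/-- Coordinate covectors of the chart at `q`, cut off by `ρ`, are smooth. -/
theorem isSmoothCovector_cutoff (q : M) (α : E →L[ℝ] ℝ) (ρ : C^∞⟮𝓘(ℝ, E), M; ℝ⟯)
    (hρ : tsupport ρ ⊆ (extChartAt 𝓘(ℝ, E) q).source) :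
    IsSmoothCovector (fun p : M => ρ p • α.comp (tangentCoordChange 𝓘(ℝ, E) p q p)) := by
  intro x₀ y hy
  refine ContDiffAt.contDiffWithinAt ?_
  by_cases hq : (extChartAt 𝓘(ℝ, E) x₀).symm y ∈ (extChartAt 𝓘(ℝ, E) q).source
  · set f : E → E := extChartAt 𝓘(ℝ, E) q ∘ (extChartAt 𝓘(ℝ, E) x₀).symm with hf
    have hfs : ContDiffAt ℝ ∞ f y := by
      have := contDiffWithinAt_ext_coord_change (I := 𝓘(ℝ, E)) (n := ∞) q x₀ (y := y)
        (by rw [PartialEquiv.trans_source]; exact ⟨hy, hq⟩)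
      simpa [contDiffWithinAt_univ, hf] using this
    have h1 : ContDiffAt ℝ ∞ (fun z => (ρ ∘ (extChartAt 𝓘(ℝ, E) x₀).symm) z •
        α.comp (fderiv ℝ f z)) y :=
      ((contDiffOn_function_chart ρ x₀).contDiffAt ((isOpen_chart_target x₀).mem_nhds hy)).smul
        (contDiffAt_const.clm_comp (hfs.fderiv_right (by simp)))
    refine h1.congr_of_eventuallyEq ?_
    filter_upwards [(isOpen_chart_target x₀).mem_nhds hy,
      eventually_chart_symm hy ((isOpen_extChartAt_source q).mem_nhds hq)] with z hz hzq
    have key : fderiv ℝ f z = tangentCoordChange 𝓘(ℝ, E) x₀ q ((extChartAt 𝓘(ℝ, E) x₀).symm z) := by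
      rw [tangentCoordChange_def, (extChartAt 𝓘(ℝ, E) x₀).right_inv hz]
      simp [hf]
    rw [key]
    ext v
    simp only [chartCovector, ContinuousLinearMap.comp_apply, smul_apply, Function.comp_apply]
    rw [tangentCoordChange_comp ⟨⟨mem_target_source hz, mem_extChartAt_source _⟩, hzq⟩]
  · have h0 : ∀ᶠ p in nhds ((extChartAt 𝓘(ℝ, E) x₀).symm y), ρ p = 0 :=
      notMem_tsupport_iff_eventuallyEq.1 fun h => hq (hρ h)
    refine (contDiffAt_const (c := 0)).congr_of_eventuallyEq ?_
    filter_upwards [eventually_chart_symm hy h0] with z hz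
    rw [chartCovector, hz, zero_smul, ContinuousLinearMap.zero_comp]

/-- Coordinate vectors of the chart at `q`, cut off by `ρ`, are smooth. -/
theorem isSmoothVector_cutoff (q : M) (v : E) (ρ : C^∞⟮𝓘(ℝ, E), M; ℝ⟯)
    (hρ : tsupport ρ ⊆ (extChartAt 𝓘(ℝ, E) q).source) :
    IsSmoothVector (fun p : M => ρ p • tangentCoordChange 𝓘(ℝ, E) q p p v) := by
  refine ContMDiffOn.smul_section_of_tsupport (V := (TangentSpace 𝓘(ℝ, E) : M → Type _))
    (s := fun p : M => tangentCoordChange 𝓘(ℝ, E) q p p v) (ψ := ρ)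
    ρ.contMDiff.contMDiffOn (isOpen_extChartAt_source q) hρ ?_
  have h := (Bundle.Trivialization.contMDiffOn_section_baseSet_iff (IB := 𝓘(ℝ, E)) (n := ∞)
      (e := trivializationAt E (TangentSpace 𝓘(ℝ, E) (M := M)) q)
      (E := TangentSpace 𝓘(ℝ, E)) (s := fun p : M => tangentCoordChange 𝓘(ℝ, E) q p p v)).2 (by
    rw [TangentBundle.trivializationAt_baseSet, ← extChartAt_source 𝓘(ℝ, E)]
    refine (contMDiffOn_const (c := v)).congr fun p hp => ?_
    change tangentCoordChange 𝓘(ℝ, E) p q p (tangentCoordChange 𝓘(ℝ, E) q p p v) = v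
    rw [tangentCoordChange_comp ⟨⟨hp, mem_extChartAt_source _⟩, hp⟩, tangentCoordChange_self hp])
  rw [TangentBundle.trivializationAt_baseSet, ← extChartAt_source 𝓘(ℝ, E)] at h
  exact h

/-- A local frame of `𝕋M` over `U`, made of global sections: vector fields and covector fields
which are dual bases over `U`. -/
structure DualFrame (U : Set M) where
  /-- The vector fields. -/
  vec : Fin (Module.finrank ℝ E) → GTSection E M
  /-- The covector fields. -/
  cov : Fin (Module.finrank ℝ E) → GTSection E M
  vec_snd : ∀ i p, ((vec i).1 p).2 = 0
  cov_fst : ∀ i p, ((cov i).1 p).1 = 0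
  dual : ∀ p ∈ U, ∀ i j, ((cov i).1 p).2 ((vec j).1 p).1 = if i = j then 1 else 0
  resolution : ∀ p ∈ U, IsResolution (fun i => ((cov i).1 p).2) (fun i => ((vec i).1 p).1)

theorem exists_dualFrame [FiniteDimensional ℝ E] [T2Space M] (q : M) :
    ∃ U : Set M, IsOpen U ∧ q ∈ U ∧ Nonempty (DualFrame (E := E) U) := by
  let ρ₀ : SmoothBumpFunction 𝓘(ℝ, E) q := Classical.choice inferInstance
  let ρ : C^∞⟮𝓘(ℝ, E), M; ℝ⟯ := ⟨ρ₀, ρ₀.contMDiff⟩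
  have hρ : tsupport ρ ⊆ (extChartAt 𝓘(ℝ, E) q).source := ρ₀.tsupport_subset_extChartAt_source
  obtain ⟨U, hU, hUo, hqU⟩ := mem_nhds_iff.1 (Filter.inter_mem (show {p | ρ p = 1} ∈ nhds q from
    ρ₀.eventuallyEq_one) ((isOpen_extChartAt_source (I := 𝓘(ℝ, E)) q).mem_nhds
      (mem_extChartAt_source q)))
  let b := Module.finBasis ℝ E
  have hd : ∀ p ∈ U, ∀ (α : E →L[ℝ] ℝ) (v : E),
      (ρ p • α.comp (tangentCoordChange 𝓘(ℝ, E) p q p))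
        (ρ p • tangentCoordChange 𝓘(ℝ, E) q p p v) = α v := fun p hp α v => by
    obtain ⟨h1, h2⟩ := hU hp
    rw [show ρ p = 1 from h1, one_smul, one_smul, ContinuousLinearMap.comp_apply,
      tangentCoordChange_comp ⟨⟨h2, mem_extChartAt_source _⟩, h2⟩, tangentCoordChange_self h2]
  refine ⟨U, hUo, hqU, ⟨{
    vec := fun i => ⟨fun p => (ρ p • tangentCoordChange 𝓘(ℝ, E) q p p (b i), 0),
      isSmoothVector_cutoff q _ ρ hρ, IsSmoothCovector.zero⟩
    cov := fun i => ⟨fun p => (0, ρ p •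
        (LinearMap.toContinuousLinearMap (b.coord i)).comp (tangentCoordChange 𝓘(ℝ, E) p q p)),
      IsSmoothVector.zero, isSmoothCovector_cutoff q _ ρ hρ⟩
    vec_snd := fun _ _ => rfl
    cov_fst := fun _ _ => rfl
    dual := fun p hp i j => by
      refine (hd p hp _ _).trans ?_
      simp [Finsupp.single_apply, eq_comm]
    resolution := fun p hp v => ?_ }⟩⟩
  obtain ⟨h1, h2⟩ := hU hp
  change ∑ i, (ρ p • (LinearMap.toContinuousLinearMap (b.coord i)).comp
    (tangentCoordChange 𝓘(ℝ, E) p q p)) v • ρ p • tangentCoordChange 𝓘(ℝ, E) q p p (b i) = v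
  rw [show ρ p = 1 from h1]
  simp only [one_smul, ContinuousLinearMap.comp_apply, LinearMap.coe_toContinuousLinearMap',
    ← map_smul, ← map_sum]
  rw [show ∑ i, b.coord i (tangentCoordChange 𝓘(ℝ, E) p q p v) • b i =
    tangentCoordChange 𝓘(ℝ, E) p q p v from b.sum_repr _,
    tangentCoordChange_comp ⟨⟨mem_extChartAt_source _, h2⟩, mem_extChartAt_source _⟩,
    tangentCoordChange_self (mem_extChartAt_source _)]

end Frames

section Operators

variable {E : Type*} [NormedAddCommGroup E] [NormedSpace ℝ E]
  {M : Type*} [TopologicalSpace M] [ChartedSpace E M] [IsManifold 𝓘(ℝ, E) ∞ M]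

/-! ### Pointwise description and locality of operators -/

/-- The inclusion of `𝓔(M)` into the endomorphisms of `Ω(M)`. -/
def toEnd : Ops E M →ₐ[ℝ] Module.End ℝ (DiffForms E M) := (opsSubalgebra E M).val

/-- The value of a differential form at a point. -/
def atPoint (p : M) : DiffForms E M →ₗ[ℝ] Fib E where
  toFun η k := η.1 k p
  map_add' _ _ := rfl
  map_smul' _ _ := rfl

theorem diffForms_ext {η ζ : DiffForms E M} (h : ∀ p, atPoint p η = atPoint p ζ) : η = ζ :=
  Subtype.ext <| funext fun k => funext fun p => congrFun (h p) k

theorem ops_ext {A B : Ops E M} (h : ∀ η p, atPoint p (toEnd A η) = atPoint p (toEnd B η)) :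
    A = B :=
  Subtype.ext <| LinearMap.ext fun η => diffForms_ext (h η)

theorem atPoint_sectionOp (x : GTSection E M) (η : DiffForms E M) (p : M) :
    atPoint p (toEnd (sectionOp x) η) = clifford (x.1 p) (atPoint p η) :=
  funext fun
    | 0 => rfl
    | _ + 1 => rfl

theorem atPoint_mulOp (f : C^∞⟮𝓘(ℝ, E), M; ℝ⟯) (η : DiffForms E M) (p : M) :
    atPoint p (toEnd (mulOp f) η) = f p • atPoint p η := rfl

theorem atPoint_parity (η : DiffForms E M) (p : M) :
    atPoint p (toEnd (parity E M) η) = fibParity (atPoint p η) := rfl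

theorem atPoint_oneForm_succ (p : M) (k : ℕ) : atPoint p (oneForm E M) (k + 1) = 0 := rfl

theorem toEnd_mul_apply (A B : Ops E M) (η : DiffForms E M) :
    toEnd (A * B) η = toEnd A (toEnd B η) := rfl

theorem toEnd_add_apply (A B : Ops E M) (η : DiffForms E M) :
    toEnd (A + B) η = toEnd A η + toEnd B η := rfl

theorem toEnd_sub_apply (A B : Ops E M) (η : DiffForms E M) :
    toEnd (A - B) η = toEnd A η - toEnd B η := rfl

theorem toEnd_smul_apply (c : ℝ) (A : Ops E M) (η : DiffForms E M) :
    toEnd (c • A) η = c • toEnd A η := rfl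

/-- The value of `A η` at `p` only depends on `η` in a neighbourhood of `p`. -/
theorem atPoint_congr (A : Ops E M) {U : Set M} (hU : IsOpen U) {η ζ : DiffForms E M}
    (h : ∀ p ∈ U, atPoint p η = atPoint p ζ) {p : M} (hp : p ∈ U) :
    atPoint p (toEnd A η) = atPoint p (toEnd A ζ) := by
  rw [← sub_eq_zero, ← map_sub, ← map_sub]
  exact funext fun k => A.2 U hU (η - ζ) (fun j q hq => by
    have := congrFun (h q hq) j
    change η.1 j q - ζ.1 j q = 0
    exact sub_eq_zero.2 this) k p hp

/-! ### Graded commutators -/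

theorem parity_mul_self : parity E M * parity E M = 1 :=
  ops_ext fun η p => by
    rw [toEnd_mul_apply, atPoint_parity, atPoint_parity]
    exact LinearMap.congr_fun fibParity_mul_self _

theorem parity_mul_sectionOp (x : GTSection E M) :
    parity E M * sectionOp x * parity E M = -sectionOp x := by
  have h : parity E M * sectionOp x + sectionOp x * parity E M = 0 := ops_ext fun η p => by
    rw [toEnd_add_apply, toEnd_mul_apply, toEnd_mul_apply, map_add, atPoint_parity,
      atPoint_sectionOp, atPoint_sectionOp, atPoint_parity]
    exact LinearMap.congr_fun (fibParity_mul_clifford_add (x.1 p)) _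
  rw [eq_neg_of_add_eq_zero_left h, neg_mul, mul_assoc, parity_mul_self, mul_one]

theorem parity_mul_deRham : parity E M * deRham E M * parity E M = -deRham E M := by
  have h : deRham E M * parity E M = -(parity E M * deRham E M) := ops_ext fun η p => by
    refine funext fun k => ?_
    match k with
    | 0 => exact (show (0 : E [⋀^Fin 0]→L[ℝ] ℝ) = -(((-1 : ℝ) ^ 0) • 0) by simp)
    | k + 1 =>
      change extD (((-1 : ℝ) ^ k) • η.1 k) p = -(((-1 : ℝ) ^ (k + 1)) • extD (η.1 k) p)
      rw [extD_smul, Pi.smul_apply, pow_succ]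
      module
  rw [mul_assoc, h, mul_neg, ← mul_assoc, parity_mul_self, one_mul]

theorem evenPart_add_oddPart (A : Ops E M) : evenPart A + oddPart A = A := by
  simp only [evenPart, oddPart]
  module

theorem oddPart_eq_zero_iff {A : Ops E M} :
    oddPart A = 0 ↔ parity E M * A * parity E M = A := by
  rw [oddPart, smul_eq_zero, sub_eq_zero]
  simp [eq_comm]

theorem evenPart_eq_zero_iff {A : Ops E M} :
    evenPart A = 0 ↔ parity E M * A * parity E M = -A := by
  rw [evenPart, smul_eq_zero, add_comm, add_eq_zero_iff_eq_neg]
  simp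

theorem gcomm_of_even {A : Ops E M} (hA : oddPart A = 0) (B : Ops E M) :
    gcomm A B = A * B - B * A := by
  have h1 := evenPart_add_oddPart A
  have h2 := evenPart_add_oddPart B
  rw [hA, add_zero] at h1
  rw [gcomm, hA, h1, mul_zero, mul_zero, add_zero, sub_zero, ← add_mul, h2]

theorem gcomm_of_odd {A B : Ops E M} (hA : evenPart A = 0) (hB : evenPart B = 0) :
    gcomm A B = A * B + B * A := by
  have h1 := evenPart_add_oddPart A
  have h2 := evenPart_add_oddPart B
  rw [hA, zero_add] at h1
  rw [hB, zero_add] at h2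
  rw [gcomm, hA, hB, h1, h2]
  noncomm_ring

theorem evenPart_sectionOp (x : GTSection E M) : evenPart (sectionOp x) = 0 :=
  evenPart_eq_zero_iff.2 (parity_mul_sectionOp x)

/-- The Clifford relation `x y + y x = 2 ⟨x, y⟩` for sections of `𝕋M`. -/
theorem sectionOp_mul_add (x y : GTSection E M) :
    sectionOp x * sectionOp y + sectionOp y * sectionOp x = mulOp (pairingFunction x y) :=
  ops_ext fun η p => by
    rw [toEnd_add_apply, toEnd_mul_apply, toEnd_mul_apply, map_add, atPoint_mulOp,
      atPoint_sectionOp, atPoint_sectionOp, atPoint_sectionOp, atPoint_sectionOp,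
      pairingFunction_apply]
    exact LinearMap.congr_fun (clifford_mul_add (x.1 p) (y.1 p)) _

theorem mulOp_mul_sectionOp (f : C^∞⟮𝓘(ℝ, E), M; ℝ⟯) (x : GTSection E M) :
    mulOp f * sectionOp x = sectionOp (funSmul f x) :=
  ops_ext fun η p => by
    rw [toEnd_mul_apply, atPoint_mulOp, atPoint_sectionOp, atPoint_sectionOp]
    change _ = clifford (f p • x.1 p) _
    rw [map_smul]; rfl

theorem sectionOp_mul_mulOp (f : C^∞⟮𝓘(ℝ, E), M; ℝ⟯) (x : GTSection E M) :
    sectionOp x * mulOp f = mulOp f * sectionOp x :=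
  ops_ext fun η p => by
    rw [toEnd_mul_apply, toEnd_mul_apply, atPoint_mulOp, atPoint_sectionOp, atPoint_sectionOp,
      atPoint_mulOp, map_smul]

/-! ### Existence of the lift -/

/-- The vector part of a section of `𝕋M`. -/
def vectorPart (x : GTSection E M) : GTSection E M :=
  ⟨fun p => ((x.1 p).1, 0), x.2.1, IsSmoothCovector.zero⟩

/-- The covector part of a section of `𝕋M`. -/
def covectorPart (x : GTSection E M) : GTSection E M :=
  ⟨fun p => (0, (x.1 p).2), IsSmoothVector.zero, x.2.2⟩

theorem DualFrame.vec_eq {U : Set M} (F : DualFrame (E := E) U) (i) (p : M) :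
    (F.vec i).1 p = (((F.vec i).1 p).1, 0) := Prod.ext rfl (F.vec_snd i p)

theorem DualFrame.cov_eq {U : Set M} (F : DualFrame (E := E) U) (i) (p : M) :
    (F.cov i).1 p = (0, ((F.cov i).1 p).2) := Prod.ext (F.cov_fst i p) rfl

/-- The expression of the lift of `φ` in a local frame. -/
def frameLift (φ : SkewEndo E M) {U : Set M} (F : DualFrame (E := E) U) : Ops E M :=
  ∑ i, (sectionOp (covectorPart (φ.onSections (F.cov i))) * sectionOp (F.vec i) -
    (1 / 2 : ℝ) • (sectionOp (F.cov i) * sectionOp (covectorPart (φ.onSections (F.vec i)))) -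
    (1 / 2 : ℝ) • (sectionOp (F.vec i) * sectionOp (vectorPart (φ.onSections (F.cov i)))))

theorem atPoint_frameLift (φ : SkewEndo E M) {U : Set M} (F : DualFrame (E := E) U)
    (η : DiffForms E M) (p : M) :
    atPoint p (toEnd (frameLift φ F) η) =
      cliffordLift (φ.fiber p) (fun i => ((F.cov i).1 p).2) (fun i => ((F.vec i).1 p).1)
        (atPoint p η) := by
  rw [frameLift, map_sum, LinearMap.sum_apply, map_sum, cliffordLift, LinearMap.sum_apply]
  refine Finset.sum_congr rfl fun i _ => ?_
  simp only [toEnd_mul_apply, map_sub, map_smul,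
    atPoint_sectionOp, LinearMap.sub_apply, LinearMap.smul_apply, Module.End.mul_apply]
  rw [← F.vec_eq i p, ← F.cov_eq i p]
  rfl

theorem isResolution_finBasis [FiniteDimensional ℝ E] :
    IsResolution (fun i => LinearMap.toContinuousLinearMap ((Module.finBasis ℝ E).coord i))
      (Module.finBasis ℝ E) := fun v => (Module.finBasis ℝ E).sum_repr v

variable [FiniteDimensional ℝ E] [T2Space M]

/-- The lift of `φ`, acting at every point by the Clifford lift of `φ` at this point. -/
def lift (φ : SkewEndo E M) : Ops E M :=
  ⟨{  toFun η := ⟨fun k p => cliffordLift (φ.fiber p)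
          (fun i => LinearMap.toContinuousLinearMap ((Module.finBasis ℝ E).coord i))
          (Module.finBasis ℝ E) (atPoint p η) k, fun k => .of_locally fun q => by
        obtain ⟨U, hU, hq, ⟨F⟩⟩ := exists_dualFrame (E := E) q
        refine ⟨fun p => (toEnd (frameLift φ F) η).1 k p, (toEnd (frameLift φ F) η).2 k, ?_⟩
        filter_upwards [hU.mem_nhds hq] with p hp
        have := congrFun (atPoint_frameLift φ F η p) k
        rw [cliffordLift_eq _ (F.resolution p hp) isResolution_finBasis] at this
        exact this.symm⟩
      map_add' η ζ := diffForms_ext fun p => by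
        exact LinearMap.map_add (cliffordLift (φ.fiber p) _ _) (atPoint p η) (atPoint p ζ)
      map_smul' c η := diffForms_ext fun p => by
        exact LinearMap.map_smul (cliffordLift (φ.fiber p) _ _) c (atPoint p η) },
    fun U _ η hη k p hp => by
      have h : atPoint p η = 0 := funext fun j => hη j p hp
      change cliffordLift _ _ _ (atPoint p η) k = 0
      rw [h, map_zero]; rfl⟩

theorem atPoint_lift (φ : SkewEndo E M) (η : DiffForms E M) (p : M) :
    atPoint p (toEnd (lift φ) η) = cliffordLift (φ.fiber p)
          (fun i => LinearMap.toContinuousLinearMap ((Module.finBasis ℝ E).coord i))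
          (Module.finBasis ℝ E) (atPoint p η) := rfl

theorem isLift_lift (φ : SkewEndo E M) : φ.IsLift (lift φ) := by
  have he : oddPart (lift φ) = 0 := by
    have h : parity E M * lift φ = lift φ * parity E M := ops_ext fun η p => by
      rw [toEnd_mul_apply, toEnd_mul_apply, atPoint_parity, atPoint_lift, atPoint_lift,
        atPoint_parity]
      exact LinearMap.congr_fun (fibParity_mul_cliffordLift _ _ _) _
    rw [oddPart_eq_zero_iff, h, mul_assoc, parity_mul_self, mul_one]
  refine ⟨he, fun f => ?_, fun x => ?_, fun k hk => ?_⟩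
  · rw [gcomm_of_even he, sub_eq_zero]
    exact ops_ext fun η p => by
      rw [toEnd_mul_apply, toEnd_mul_apply, atPoint_mulOp, atPoint_lift, atPoint_lift,
        atPoint_mulOp, map_smul]
  · rw [gcomm_of_even he]
    refine ops_ext fun η p => ?_
    rw [toEnd_sub_apply, toEnd_mul_apply, toEnd_mul_apply, map_sub, atPoint_sectionOp,
      atPoint_lift, atPoint_lift, atPoint_sectionOp, atPoint_sectionOp]
    exact LinearMap.congr_fun
      (cliffordLift_commutator (φ.skew p) isResolution_finBasis (x.1 p)) _
  · exact funext fun p => cliffordLift_apply_of_scalar _ _ _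
      (fun j => atPoint_oneForm_succ p j) hk

end Operators

section Centralizer

variable {E : Type*} [NormedAddCommGroup E] [NormedSpace ℝ E]
  {M : Type*} [TopologicalSpace M] [ChartedSpace E M] [IsManifold 𝓘(ℝ, E) ∞ M]

/-! ### Operators supercommuting with all sections -/

theorem IsResolution.eq_zero_of_contract {ι : Type*} [Fintype ι] {γ : ι → E →L[ℝ] ℝ} {w : ι → E}
    (h : IsResolution γ w) {k : ℕ} {η : E [⋀^Fin (k + 1)]→L[ℝ] ℝ}
    (hη : ∀ i, contract (w i) η = 0) : η = 0 := by
  have h1 := h.sum_wedge_contract η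
  simp only [hη, wedge_zero, Finset.sum_const_zero] at h1
  have h2 : (k : ℝ) + 1 ≠ 0 := by positivity
  exact (smul_eq_zero.1 h1.symm).resolve_left h2

theorem form_eq_zero_of_finrank_lt [FiniteDimensional ℝ E] {k : ℕ} (hk : Module.finrank ℝ E < k)
    (η : E [⋀^Fin k]→L[ℝ] ℝ) : η = 0 := by
  ext v
  refine η.toAlternatingMap.map_linearDependent v fun hv => ?_
  have := hv.fintype_card_le_finrank
  rw [Fintype.card_fin] at this
  omega

theorem atPoint_vec {U : Set M} (F : DualFrame (E := E) U) (i) (η : DiffForms E M) (p : M)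
    (k : ℕ) : atPoint p (toEnd (sectionOp (F.vec i)) η) k =
      contract ((F.vec i).1 p).1 (atPoint p η (k + 1)) := by
  rw [atPoint_sectionOp, F.vec_eq, clifford_vector_apply]

theorem atPoint_cov_zero {U : Set M} (F : DualFrame (E := E) U) (i) (η : DiffForms E M) (p : M) :
    atPoint p (toEnd (sectionOp (F.cov i)) η) 0 = 0 := by
  rw [atPoint_sectionOp, F.cov_eq, clifford_covector_apply_zero]

theorem atPoint_cov_succ {U : Set M} (F : DualFrame (E := E) U) (i) (η : DiffForms E M) (p : M)
    (k : ℕ) : atPoint p (toEnd (sectionOp (F.cov i)) η) (k + 1) =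
      wedge ((F.cov i).1 p).2 (atPoint p η k) := by
  rw [atPoint_sectionOp, F.cov_eq, clifford_covector_apply_succ]

theorem vec_oneForm {U : Set M} (F : DualFrame (E := E) U) (i) :
    toEnd (sectionOp (F.vec i)) (oneForm E M) = 0 :=
  diffForms_ext fun p => funext fun k => by
    rw [atPoint_vec, atPoint_oneForm_succ, contract_zero]; rfl

/-- Every function is locally of the form `2 ⟨x, y⟩`. -/
theorem DualFrame.pairingFunction_funSmul {U : Set M} (F : DualFrame (E := E) U) (i)
    (f : C^∞⟮𝓘(ℝ, E), M; ℝ⟯) {p : M} (hp : p ∈ U) :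
    pairingFunction (F.vec i) (funSmul f (F.cov i)) p = f p := by
  change ((F.vec i).1 p).2 (f p • ((F.cov i).1 p).1) +
    (f p • ((F.cov i).1 p).2) ((F.vec i).1 p).1 = f p
  have h : ((F.cov i).1 p).2 ((F.vec i).1 p).1 = 1 := by rw [F.dual p hp, if_pos rfl]
  rw [F.vec_snd, smul_apply, h]
  simp

theorem atPoint_mulOp_oneForm_succ (f : C^∞⟮𝓘(ℝ, E), M; ℝ⟯) (p : M) (k : ℕ) :
    atPoint p (toEnd (mulOp f) (oneForm E M)) (k + 1) = 0 := by
  change f p • atPoint p (oneForm E M) (k + 1) = 0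
  rw [atPoint_oneForm_succ, smul_zero]

theorem atPoint_mulOp_oneForm_zero {η : M → E [⋀^Fin 0]→L[ℝ] ℝ} (hη : IsSmoothForm η) (p : M) :
    atPoint p (toEnd (mulOp hη.toFunction) (oneForm E M)) 0 = η p := by
  ext v
  change η p ![] * 1 = η p v
  rw [mul_one]
  congr 1
  exact Subsingleton.elim _ _

variable [FiniteDimensional ℝ E] [T2Space M]

/-- An operator supercommuting with all sections maps `1` to a function, because
`ι_X D(1) = ± D(ι_X 1) = 0`. -/
theorem apply_oneForm_succ {D : Ops E M} {ε : ℝ} (hε : ε ≠ 0)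
    (hD : ∀ x, D * sectionOp x = ε • (sectionOp x * D)) (p : M) (k : ℕ) :
    atPoint p (toEnd D (oneForm E M)) (k + 1) = 0 := by
  obtain ⟨U, hU, hp, ⟨F⟩⟩ := exists_dualFrame (E := E) p
  refine (F.resolution p hp).eq_zero_of_contract fun i => ?_
  have h1 := congrArg (fun A => toEnd A (oneForm E M)) (hD (F.vec i))
  simp only [toEnd_mul_apply, toEnd_smul_apply, vec_oneForm, map_zero] at h1
  have h2 := (smul_eq_zero.1 h1.symm).resolve_left hε
  have h3 := congrFun (congrArg (atPoint p) h2) k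
  rw [atPoint_vec] at h3
  exact h3

variable [Nontrivial E]

/-- An operator supercommuting with all sections and killing `1` is zero: locally every form is
obtained from `1` by the action of sections, by Euler's identity. -/
theorem eq_zero_of_supercommute {D : Ops E M} {ε : ℝ}
    (hD : ∀ x, D * sectionOp x = ε • (sectionOp x * D)) (h1 : toEnd D (oneForm E M) = 0) :
    D = 0 := by
  have hD' : ∀ x η, toEnd D η = 0 → toEnd D (toEnd (sectionOp x) η) = 0 := fun x η h => by
    rw [← toEnd_mul_apply, hD, toEnd_smul_apply, toEnd_mul_apply, h, map_zero, smul_zero]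
  -- Locally, a function is an anticommutator of sections.
  have hfun : ∀ f, toEnd D (toEnd (mulOp f) (oneForm E M)) = 0 := fun f =>
    diffForms_ext fun p => by
      obtain ⟨U, hU, hp, ⟨F⟩⟩ := exists_dualFrame (E := E) p
      let i : Fin (Module.finrank ℝ E) := ⟨0, Module.finrank_pos⟩
      let g := pairingFunction (F.vec i) (funSmul f (F.cov i))
      have hg : toEnd D (toEnd (mulOp g) (oneForm E M)) = 0 := by
        rw [← sectionOp_mul_add, toEnd_add_apply, toEnd_mul_apply, toEnd_mul_apply, map_add,
          hD' _ _ (hD' _ _ h1), hD' _ _ (hD' _ _ h1), add_zero]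
      rw [atPoint_congr D hU (ζ := toEnd (mulOp g) (oneForm E M)) (fun q hq => by
        rw [atPoint_mulOp, atPoint_mulOp, F.pairingFunction_funSmul i f hq]) hp, hg]
  -- Induction on the degree.
  have hdeg : ∀ (n : ℕ) (η : DiffForms E M), (∀ k, n < k → η.1 k = 0) → toEnd D η = 0 := by
    intro n
    induction n with
    | zero =>
      intro η hη
      rw [← hfun (η.2 0).toFunction]
      congr 1
      refine diffForms_ext fun p => funext fun k => ?_
      match k with
      | 0 => exact (atPoint_mulOp_oneForm_zero (η.2 0) p).symm
      | k + 1 =>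
        rw [atPoint_mulOp_oneForm_succ]
        exact congrFun (hη (k + 1) k.succ_pos) p
    | succ n ih =>
      intro η hη
      refine diffForms_ext fun p => ?_
      obtain ⟨U, hU, hp, ⟨F⟩⟩ := exists_dualFrame (E := E) p
      -- By Euler's identity `η = η₀ + ∑ i, γ_i ∧ ι_{w_i} ζ` near `p`, where `ζ_k = η_k / k`.
      let ζ : DiffForms E M := ⟨fun k => (k : ℝ)⁻¹ • η.1 k, fun k => (η.2 k).const_smul _⟩
      have hvec : ∀ i, toEnd D (toEnd (sectionOp (F.vec i)) ζ) = 0 := fun i => by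
        refine ih _ fun k hk => funext fun q => ?_
        refine (atPoint_vec F i ζ q k).trans ?_
        change contract _ (((k + 1 : ℕ) : ℝ)⁻¹ • η.1 (k + 1) q) = 0
        rw [hη (k + 1) (by omega), Pi.zero_apply, smul_zero, contract_zero]
      let ξ : DiffForms E M := toEnd (mulOp (η.2 0).toFunction) (oneForm E M) +
        ∑ i, toEnd (sectionOp (F.cov i)) (toEnd (sectionOp (F.vec i)) ζ)
      have hξ : toEnd D ξ = 0 := by
        rw [map_add, hfun, map_sum, Finset.sum_eq_zero fun i _ => hD' _ _ (hvec i), add_zero]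
      rw [atPoint_congr D hU (ζ := ξ) (fun q hq => ?_) hp, hξ]
      have hξq : ∀ k, atPoint q ξ k = atPoint q (toEnd (mulOp (η.2 0).toFunction) (oneForm E M)) k +
          ∑ i, atPoint q (toEnd (sectionOp (F.cov i)) (toEnd (sectionOp (F.vec i)) ζ)) k :=
        fun k => by
          rw [← Fib.sum_apply, ← map_sum]; rfl
      refine funext fun k => ?_
      rw [hξq]
      match k with
      | 0 =>
        rw [Finset.sum_eq_zero fun i _ => atPoint_cov_zero F i _ q, add_zero]
        exact (atPoint_mulOp_oneForm_zero (η.2 0) q).symm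
      | k + 1 =>
        have h2 : ∀ i, atPoint q (toEnd (sectionOp (F.cov i))
            (toEnd (sectionOp (F.vec i)) ζ)) (k + 1) = wedge ((F.cov i).1 q).2
              (contract ((F.vec i).1 q).1 (ζ.1 (k + 1) q)) := fun i => by
          rw [atPoint_cov_succ, atPoint_vec]; rfl
        rw [atPoint_mulOp_oneForm_succ, zero_add, Finset.sum_congr rfl fun i _ => h2 i,
          (F.resolution q hq).sum_wedge_contract]
        change η.1 (k + 1) q = ((k : ℝ) + 1) • ((k + 1 : ℕ) : ℝ)⁻¹ • η.1 (k + 1) q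
        rw [smul_smul, Nat.cast_succ, mul_inv_cancel₀ (by positivity), one_smul]
  refine ops_ext fun η p => ?_
  rw [hdeg (Module.finrank ℝ E) η fun k hk => funext fun p => form_eq_zero_of_finrank_lt hk _]
  rfl

theorem SkewEndo.IsLift.unique {φ : SkewEndo E M} {T T' : Ops E M} (hT : φ.IsLift T)
    (hT' : φ.IsLift T') : T' = T := by
  have hc : ∀ x, (T' - T) * sectionOp x = (1 : ℝ) • (sectionOp x * (T' - T)) := fun x => by
    have h1 := hT.sections x
    have h2 := hT'.sections x
    rw [gcomm_of_even hT.even] at h1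
    rw [gcomm_of_even hT'.even, ← h1, sub_eq_sub_iff_sub_eq_sub] at h2
    rw [one_smul, sub_mul, mul_sub, h2]
  refine sub_eq_zero.1 (eq_zero_of_supercommute hc (diffForms_ext fun p => funext fun k => ?_))
  match k with
  | 0 =>
    change (T'.1 (oneForm E M)).1 0 p - (T.1 (oneForm E M)).1 0 p = 0
    rw [hT.normalized 0 (by norm_num), hT'.normalized 0 (by norm_num), sub_self]
  | k + 1 => exact apply_oneForm_succ one_ne_zero hc p k

theorem eq_mulOp_of_commute {D : Ops E M} (hD : ∀ x, D * sectionOp x = sectionOp x * D) :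
    D = mulOp ((toEnd D (oneForm E M)).2 0).toFunction := by
  have hc : ∀ x, D * sectionOp x = (1 : ℝ) • (sectionOp x * D) := fun x => by
    rw [hD, one_smul]
  refine sub_eq_zero.1 (eq_zero_of_supercommute (ε := 1) (fun x => ?_)
    (diffForms_ext fun p => funext fun k => ?_))
  · rw [sub_mul, mul_sub, hD, sectionOp_mul_mulOp, one_smul]
  · rw [toEnd_sub_apply, map_sub]
    change atPoint p _ k - atPoint p _ k = 0
    rw [sub_eq_zero]
    match k with
    | 0 => exact (atPoint_mulOp_oneForm_zero _ p).symm
    | k + 1 => rw [atPoint_mulOp_oneForm_succ, apply_oneForm_succ one_ne_zero hc]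

end Centralizer

section Torsion

variable {E : Type*} [NormedAddCommGroup E] [NormedSpace ℝ E]
  {M : Type*} [TopologicalSpace M] [ChartedSpace E M] [IsManifold 𝓘(ℝ, E) ∞ M]

/-! ### Odd operators with vanishing derived bracket -/

theorem mem_GT_iff {A : Ops E M} : A ∈ GT E M ↔ ∃ x, sectionOp x = A := Iff.rfl

theorem two_mul_pairing (u v : E × (E →L[ℝ] ℝ)) : 2 * pairing u v = u.2 v.1 + v.2 u.1 := by
  simp only [pairing]; ring

theorem parity_conj_mul (A B : Ops E M) : parity E M * (A * B) * parity E M =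
    (parity E M * A * parity E M) * (parity E M * B * parity E M) := by
  have h : (parity E M * A * parity E M) * (parity E M * B * parity E M) =
    parity E M * A * (parity E M * parity E M) * B * parity E M := by noncomm_ring
  rw [h, parity_mul_self]
  noncomm_ring

theorem oddPart_of_odd_mul_add {A B : Ops E M} (hA : evenPart A = 0) (hB : evenPart B = 0) :
    oddPart (A * B + B * A) = 0 := by
  rw [evenPart_eq_zero_iff] at hA hB
  rw [oddPart_eq_zero_iff]
  rw [mul_add, add_mul, parity_conj_mul, parity_conj_mul, hA, hB, neg_mul_neg, neg_mul_neg]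

theorem derivedBracket_of_odd {δ : Ops E M} (hδ : evenPart δ = 0) (x y : GTSection E M) :
    derivedBracket δ (sectionOp x) (sectionOp y) =
      (sectionOp x * δ + δ * sectionOp x) * sectionOp y -
        sectionOp y * (sectionOp x * δ + δ * sectionOp x) := by
  rw [derivedBracket, gcomm_of_odd (evenPart_sectionOp x) hδ,
    gcomm_of_even (oddPart_of_odd_mul_add (evenPart_sectionOp x) hδ)]

/-- A section of `𝕋M` at a point is expanded in a local frame. -/
theorem DualFrame.expand {U : Set M} (F : DualFrame (E := E) U) {p : M} (hp : p ∈ U)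
    (u : E × (E →L[ℝ] ℝ)) :
    ∑ i, ((2 * pairing ((F.cov i).1 p) u) • (F.vec i).1 p +
      (2 * pairing ((F.vec i).1 p) u) • (F.cov i).1 p) = u := by
  have h := F.resolution p hp
  have e1 : ∀ i, 2 * pairing ((F.cov i).1 p) u = ((F.cov i).1 p).2 u.1 := fun i => by
    rw [two_mul_pairing, F.cov_fst, map_zero, add_zero]
  have e2 : ∀ i, 2 * pairing ((F.vec i).1 p) u = u.2 ((F.vec i).1 p).1 := fun i => by
    rw [two_mul_pairing, F.vec_snd, zero_apply, zero_add]
  refine Prod.ext ?_ ?_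
  · simp only [Prod.fst_sum, Prod.fst_add, Prod.smul_fst, F.cov_fst, smul_zero, add_zero, e1]
    exact h u.1
  · simp only [Prod.snd_sum, Prod.snd_add, Prod.smul_snd, F.vec_snd, smul_zero, zero_add, e2]
    exact h.dual u.2

theorem pairing_add_left (u u' v : E × (E →L[ℝ] ℝ)) :
    pairing (u + u') v = pairing u v + pairing u' v := by
  simp only [pairing, Prod.fst_add, Prod.snd_add, map_add, add_apply]; ring

theorem pairing_comm (u v : E × (E →L[ℝ] ℝ)) : pairing u v = pairing v u := by
  simp only [pairing, add_comm]

/-- The component of degree `0` of `[x, δ](1)`, for an odd operator `δ`. If `[x, δ]` is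
multiplication by a function, it is this function. -/
def bracketFunction (δ : Ops E M) (x : GTSection E M) : C^∞⟮𝓘(ℝ, E), M; ℝ⟯ :=
  ((toEnd (sectionOp x * δ + δ * sectionOp x) (oneForm E M)).2 0).toFunction

theorem bracketFunction_apply (δ : Ops E M) (x : GTSection E M) (p : M) :
    bracketFunction δ x p =
      atPoint p (toEnd (sectionOp x * δ + δ * sectionOp x) (oneForm E M)) 0 ![] := rfl

theorem bracketFunction_add (δ : Ops E M) (x y : GTSection E M) (p : M) :
    bracketFunction δ (x + y) p = bracketFunction δ x p + bracketFunction δ y p := by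
  rw [bracketFunction_apply, sectionOp_add, add_mul, mul_add, add_add_add_comm]
  rfl

theorem bracketFunction_sum (δ : Ops E M) {ι : Type*} (s : Finset ι) (x : ι → GTSection E M)
    (p : M) : bracketFunction δ (∑ i ∈ s, x i) p = ∑ i ∈ s, bracketFunction δ (x i) p :=
  map_sum (AddMonoidHom.mk' (fun x => bracketFunction δ x p)
    fun x y => bracketFunction_add δ x y p) x s

theorem bracketFunction_funSmul {δ : Ops E M}
    (h : ∀ f : C^∞⟮𝓘(ℝ, E), M; ℝ⟯, δ * mulOp f = mulOp f * δ) (f : C^∞⟮𝓘(ℝ, E), M; ℝ⟯)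
    (x : GTSection E M) (p : M) :
    bracketFunction δ (funSmul f x) p = f p * bracketFunction δ x p := by
  rw [bracketFunction_apply, ← mulOp_mul_sectionOp, mul_assoc, ← mul_assoc δ, h, mul_assoc,
    ← mul_add]
  rfl

/-- The section representing the functions `[x, δ]` in a local frame. -/
def frameSection (δ : Ops E M) {U : Set M} (F : DualFrame (E := E) U) : GTSection E M :=
  ∑ i, (funSmul (bracketFunction δ (F.vec i)) (F.cov i) +
    funSmul (bracketFunction δ (F.cov i)) (F.vec i))

theorem frameSection_apply (δ : Ops E M) {U : Set M} (F : DualFrame (E := E) U) (p : M) :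
    (frameSection δ F).1 p = ∑ i, (bracketFunction δ (F.vec i) p • (F.cov i).1 p +
      bracketFunction δ (F.cov i) p • (F.vec i).1 p) := by
  rw [frameSection, Submodule.coe_sum, Finset.sum_apply]
  rfl

variable [FiniteDimensional ℝ E] [T2Space M]

theorem mulOp_congr_on {f g : C^∞⟮𝓘(ℝ, E), M; ℝ⟯} (A : Ops E M) {U : Set M} (hU : IsOpen U)
    (h : ∀ p ∈ U, f p = g p) (η : DiffForms E M) {p : M} (hp : p ∈ U) :
    atPoint p (toEnd (A * mulOp f) η) = atPoint p (toEnd (A * mulOp g) η) := by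
  rw [toEnd_mul_apply, toEnd_mul_apply]
  exact atPoint_congr A hU (fun q hq => by rw [atPoint_mulOp, atPoint_mulOp, h q hq]) hp

variable [Nontrivial E]

/-- An operator commuting with all Clifford anticommutators of sections commutes with functions. -/
theorem commute_mulOp {A : Ops E M}
    (h : ∀ x y, A * mulOp (pairingFunction x y) = mulOp (pairingFunction x y) * A)
    (f : C^∞⟮𝓘(ℝ, E), M; ℝ⟯) : A * mulOp f = mulOp f * A := by
  refine ops_ext fun η p => ?_
  obtain ⟨U, hU, hp, ⟨F⟩⟩ := exists_dualFrame (E := E) p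
  let i : Fin (Module.finrank ℝ E) := ⟨0, Module.finrank_pos⟩
  rw [← mulOp_congr_on A hU (fun q hq => F.pairingFunction_funSmul i f hq) η hp, h,
    toEnd_mul_apply, toEnd_mul_apply, atPoint_mulOp, atPoint_mulOp,
    F.pairingFunction_funSmul i f hp]

/-- If `[x, δ]` commutes with all sections for every section `x`, then `δ` commutes with functions:
`[2 ⟨x, y⟩, δ] = [[x, y], δ]` is expressed by the brackets `[[x, δ], y]` and `[[y, δ], x]`. -/
theorem commute_mulOp_of_bracket {δ : Ops E M}
    (h : ∀ x y, (sectionOp x * δ + δ * sectionOp x) * sectionOp y =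
      sectionOp y * (sectionOp x * δ + δ * sectionOp x)) (f : C^∞⟮𝓘(ℝ, E), M; ℝ⟯) :
    δ * mulOp f = mulOp f * δ := by
  refine commute_mulOp (fun x y => ?_) f
  rw [← sectionOp_mul_add, ← sub_eq_zero]
  have e : ∀ a b : Ops E M, δ * (a * b + b * a) - (a * b + b * a) * δ =
      ((a * δ + δ * a) * b - b * (a * δ + δ * a)) + ((b * δ + δ * b) * a - a * (b * δ + δ * b)) :=
    fun a b => by noncomm_ring
  rw [e, h, h, sub_self, sub_self, add_zero]

theorem bracketFunction_congr (δ : Ops E M) {U : Set M} (hU : IsOpen U) {x y : GTSection E M}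
    (h : ∀ p ∈ U, x.1 p = y.1 p) {p : M} (hp : p ∈ U) :
    bracketFunction δ x p = bracketFunction δ y p := by
  have h1 : ∀ q ∈ U, atPoint q (toEnd (sectionOp x) (oneForm E M)) =
      atPoint q (toEnd (sectionOp y) (oneForm E M)) := fun q hq => by
    rw [atPoint_sectionOp, atPoint_sectionOp, h q hq]
  rw [bracketFunction_apply, bracketFunction_apply, toEnd_add_apply, toEnd_add_apply, map_add,
    map_add, toEnd_mul_apply, toEnd_mul_apply, toEnd_mul_apply, toEnd_mul_apply,
    atPoint_sectionOp, atPoint_sectionOp, h p hp, atPoint_congr δ hU h1 hp]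

/-- If `δ` commutes with functions, then `[x, δ](1)` in degree `0` is linear in `x` over functions,
and local, so it is `2 ⟨z, x⟩` for a section `z`. -/
theorem bracketFunction_eq_pairing {δ : Ops E M}
    (h : ∀ f : C^∞⟮𝓘(ℝ, E), M; ℝ⟯, δ * mulOp f = mulOp f * δ) {U : Set M} (hU : IsOpen U)
    (F : DualFrame (E := E) U) {p : M} (hp : p ∈ U) (x : GTSection E M) :
    bracketFunction δ x p = 2 * pairing ((frameSection δ F).1 p) (x.1 p) := by
  let x' : GTSection E M := ∑ i, (funSmul (pairingFunction (F.cov i) x) (F.vec i) +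
    funSmul (pairingFunction (F.vec i) x) (F.cov i))
  have hx : ∀ q ∈ U, x.1 q = x'.1 q := fun q hq => by
    rw [← F.expand hq (x.1 q), Submodule.coe_sum, Finset.sum_apply]
    refine Finset.sum_congr rfl fun i _ => ?_
    rw [← pairingFunction_apply, ← pairingFunction_apply]
    rfl
  let L : E × (E →L[ℝ] ℝ) →+ ℝ := AddMonoidHom.mk' (fun u => 2 * pairing u (x.1 p))
    fun u v => by rw [pairing_add_left, mul_add]
  have hL : ∀ (c : ℝ) u, L (c • u) = c * (2 * pairing u (x.1 p)) := fun c u => by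
    change 2 * pairing (c • u) (x.1 p) = _
    simp only [pairing, Prod.smul_fst, Prod.smul_snd, map_smul, smul_apply, smul_eq_mul]
    ring
  rw [bracketFunction_congr δ hU hx hp, bracketFunction_sum, frameSection_apply]
  change _ = L _
  rw [map_sum]
  refine Finset.sum_congr rfl fun i _ => ?_
  rw [bracketFunction_add, bracketFunction_funSmul h, bracketFunction_funSmul h, map_add, hL, hL,
    pairingFunction_apply, pairingFunction_apply]
  ring

/-- An odd operator `δ` is a section of `𝕋M` as soon as its derived bracket vanishes on sections.
Every `[x, δ]` commutes with all sections, hence is a function, depends linearly on `x` over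
functions, and so is `2 ⟨z, x⟩` for a section `z`; then `δ - z` anticommutes with all sections. -/
theorem mem_GT_iff_derivedBracket {δ : Ops E M} (hδ : evenPart δ = 0) :
    (∀ x y : GTSection E M, derivedBracket δ (sectionOp x) (sectionOp y) = 0) ↔ δ ∈ GT E M := by
  constructor
  · intro h
    have hb : ∀ x y, (sectionOp x * δ + δ * sectionOp x) * sectionOp y =
        sectionOp y * (sectionOp x * δ + δ * sectionOp x) := fun x y => by
      rw [← sub_eq_zero, ← derivedBracket_of_odd hδ, h]
    have hf := commute_mulOp_of_bracket hb
    have hg : ∀ x, sectionOp x * δ + δ * sectionOp x = mulOp (bracketFunction δ x) := fun x =>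
      eq_mulOp_of_commute (hb x)
    have hex : ∀ p : M, ∃ u, ∀ x : GTSection E M,
        bracketFunction δ x p = 2 * pairing u (x.1 p) := fun p => by
      obtain ⟨U, hU, hp, ⟨F⟩⟩ := exists_dualFrame (E := E) p
      exact ⟨_, bracketFunction_eq_pairing hf hU F hp⟩
    choose z hz using hex
    have hzs : z ∈ GTSection E M := mem_GTSection_of_locally fun q => by
      obtain ⟨U, hU, hq, ⟨F⟩⟩ := exists_dualFrame (E := E) q
      refine ⟨_, (frameSection δ F).2, ?_⟩
      filter_upwards [hU.mem_nhds hq] with p hp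
      rw [← F.expand hp (z p), frameSection_apply]
      refine Finset.sum_congr rfl fun i _ => ?_
      rw [pairing_comm _ (z p), pairing_comm _ (z p), ← hz, ← hz, add_comm]
    let z' : GTSection E M := ⟨z, hzs⟩
    have hD : ∀ x, (δ - sectionOp z') * sectionOp x =
        (-1 : ℝ) • (sectionOp x * (δ - sectionOp z')) := fun x => by
      have h1 : mulOp (bracketFunction δ x) = mulOp (pairingFunction z' x) :=
        congrArg mulOp (ContMDiffMap.ext fun p => by rw [pairingFunction_apply, hz p x])
      rw [← hg, ← sectionOp_mul_add, ← sub_eq_zero] at h1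
      rw [neg_one_smul, ← sub_eq_zero, ← h1]
      noncomm_ring
    refine ⟨z', (sub_eq_zero.1 (eq_zero_of_supercommute hD
      (diffForms_ext fun p => funext fun k => ?_))).symm⟩
    match k with
    | 0 =>
      -- An odd operator maps `1` to a form without component of degree `0`.
      have hodd : parity E M * (δ - sectionOp z') * parity E M = -(δ - sectionOp z') := by
        rw [mul_sub, sub_mul, evenPart_eq_zero_iff.1 hδ, parity_mul_sectionOp]; abel
      have h1 : toEnd (parity E M) (oneForm E M) = oneForm E M :=
        diffForms_ext fun p => funext fun k => by
          match k with
          | 0 => exact one_smul ℝ (atPoint p (oneForm E M) 0)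
          | k + 1 => exact smul_zero ((-1 : ℝ) ^ (k + 1))
      have h2 := congrArg (fun A => atPoint p (toEnd A (oneForm E M)) 0) hodd
      simp only [toEnd_mul_apply, h1, atPoint_parity] at h2
      have h3 : atPoint p (toEnd (δ - sectionOp z') (oneForm E M)) 0 =
          -atPoint p (toEnd (δ - sectionOp z') (oneForm E M)) 0 := by
        refine Eq.trans ?_ h2
        exact (one_smul ℝ _).symm
      have h4 : (2 : ℝ) • atPoint p (toEnd (δ - sectionOp z') (oneForm E M)) 0 = 0 := by
        rw [two_smul]
        nth_rewrite 1 [h3]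
        exact neg_add_cancel _
      exact (smul_eq_zero.1 h4).resolve_left two_ne_zero
    | k + 1 => exact apply_oneForm_succ (by norm_num) hD p k
  · intro h x y
    obtain ⟨z, rfl⟩ := mem_GT_iff.1 h
    rw [derivedBracket_of_odd hδ, sectionOp_mul_add, sectionOp_mul_mulOp, sub_self]

end Torsion

/-! ### Partial fractions -/

section PartialFractions

open Polynomial

theorem pow_mul_divByMonic {P : ℝ[X]} {S : Finset ℂ} {m : ℂ → ℕ}
    (hP : P.map (algebraMap ℝ ℂ) = ∏ μ ∈ S, (X - C μ) ^ m μ) {μ : ℂ} (hμ : μ ∈ S) {i : ℕ}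
    (hi : i ≤ m μ) :
    (X - C μ) ^ i * (P.map (algebraMap ℝ ℂ) /ₘ (X - C μ) ^ i) = P.map (algebraMap ℝ ℂ) := by
  have hm : ((X - C μ) ^ i).Monic := (monic_X_sub_C μ).pow i
  have hdvd : (X - C μ) ^ i ∣ P.map (algebraMap ℝ ℂ) := by
    rw [hP]
    exact (pow_dvd_pow _ hi).trans (Finset.dvd_prod_of_mem (fun μ => (X - C μ) ^ m μ) hμ)
  have h := modByMonic_add_div (P.map (algebraMap ℝ ℂ)) ((X - C μ) ^ i)
  rwa [(modByMonic_eq_zero_iff_dvd hm).2 hdvd, zero_add] at h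

/-- Multiplying a partial fraction by `P` gives a polynomial. -/
theorem algebraMap_mul_partialFraction {P : ℝ[X]} {S : Finset ℂ} {m : ℂ → ℕ}
    (hP : P.map (algebraMap ℝ ℂ) = ∏ μ ∈ S, (X - C μ) ^ m μ) {μ : ℂ} (hμ : μ ∈ S) {i : ℕ}
    (hi : i ≤ m μ) (c : ℂ) :
    algebraMap ℂ[X] (RatFunc ℂ) (P.map (algebraMap ℝ ℂ)) *
        (RatFunc.C c / (RatFunc.X - RatFunc.C μ) ^ i) =
      algebraMap ℂ[X] (RatFunc ℂ) (c • (P.map (algebraMap ℝ ℂ) /ₘ (X - C μ) ^ i)) := by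
  have h1 : algebraMap ℂ[X] (RatFunc ℂ) (X - C μ) = RatFunc.X - RatFunc.C μ := by
    rw [map_sub, RatFunc.algebraMap_X, RatFunc.algebraMap_C]
  have h2 : RatFunc.X - RatFunc.C μ ≠ 0 := by
    rw [← h1]
    exact RatFunc.algebraMap_ne_zero (X_sub_C_ne_zero μ)
  rw [mul_div_assoc', div_eq_iff (pow_ne_zero _ h2), ← h1, ← map_pow, ← RatFunc.algebraMap_C,
    ← map_mul, ← map_mul]
  congr 1
  conv_lhs => rw [← pow_mul_divByMonic hP hμ hi]
  rw [smul_eq_C_mul]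
  ring

theorem mul_sum_partialFraction {P : ℝ[X]} {S : Finset ℂ} {m : ℂ → ℕ}
    (hP : P.map (algebraMap ℝ ℂ) = ∏ μ ∈ S, (X - C μ) ^ m μ) (a : ℂ → ℕ → ℂ) :
    algebraMap ℂ[X] (RatFunc ℂ) (P.map (algebraMap ℝ ℂ)) *
        ∑ μ ∈ S, ∑ i ∈ Finset.Icc 1 (m μ), RatFunc.C (a μ i) / (RatFunc.X - RatFunc.C μ) ^ i =
      algebraMap ℂ[X] (RatFunc ℂ) (∑ μ ∈ S, ∑ i ∈ Finset.Icc 1 (m μ),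
        a μ i • (P.map (algebraMap ℝ ℂ) /ₘ (X - C μ) ^ i)) := by
  simp only [Finset.mul_sum, map_sum]
  exact Finset.sum_congr rfl fun μ hμ => Finset.sum_congr rfl fun i hi =>
    algebraMap_mul_partialFraction hP hμ (Finset.mem_Icc.1 hi).2 _

/-- A partial fraction decomposition of `1 / P` amounts to an identity of polynomials. -/
theorem isPartialFraction_iff {P : ℝ[X]} (h0 : P ≠ 0) {S : Finset ℂ} {m : ℂ → ℕ}
    (hP : P.map (algebraMap ℝ ℂ) = ∏ μ ∈ S, (X - C μ) ^ m μ) {a : ℂ → ℕ → ℂ} :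
    IsPartialFraction P S m a ↔ ∑ μ ∈ S, ∑ i ∈ Finset.Icc 1 (m μ),
      a μ i • (P.map (algebraMap ℝ ℂ) /ₘ (X - C μ) ^ i) = 1 := by
  have hne : algebraMap ℂ[X] (RatFunc ℂ) (P.map (algebraMap ℝ ℂ)) ≠ 0 :=
    RatFunc.algebraMap_ne_zero ((Polynomial.map_ne_zero_iff (algebraMap ℝ ℂ).injective).2 h0)
  rw [IsPartialFraction, eq_comm, ← mul_eq_one_iff_eq_inv₀ hne, mul_comm,
    mul_sum_partialFraction hP, map_eq_one_iff _ (RatFunc.algebraMap_injective ℂ)]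

theorem exists_isPartialFraction {P : ℝ[X]} (hd : 0 < P.natDegree) {S : Finset ℂ} {m : ℂ → ℕ}
    (hP : P.map (algebraMap ℝ ℂ) = ∏ μ ∈ S, (X - C μ) ^ m μ) :
    ∃ a, IsPartialFraction P S m a := by
  have h0 : P ≠ 0 := fun h => by simp [h] at hd
  obtain ⟨q, r, hr, h⟩ := mul_prod_pow_inverse_eq_quo_add_sum_rem_mul_pow_inverse
    (K := RatFunc ℂ) (s := S) 1 (g := fun μ => X - C μ) (fun μ _ => monic_X_sub_C μ)
    (fun μ _ ν _ hμν => pairwise_coprime_X_sub_C Function.injective_id hμν) m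
    (gi := fun μ => (algebraMap ℂ[X] (RatFunc ℂ) (X - C μ))⁻¹)
    (fun μ _ => inv_mul_cancel₀ (RatFunc.algebraMap_ne_zero (X_sub_C_ne_zero μ)))
  let a : ℂ → ℕ → ℂ := fun μ i => if hi : i - 1 < m μ then (r μ ⟨i - 1, hi⟩).coeff 0 else 0
  have hr' : ∀ μ ∈ S, ∀ j : Fin (m μ), r μ j = C (a μ (j + 1)) := fun μ hμ j => by
    have h1 := hr μ hμ j
    rw [degree_X_sub_C] at h1
    rw [eq_C_of_degree_le_zero (Nat.WithBot.lt_one_iff_le_zero.1 h1)]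
    simp [a]
  have hsum : ∑ μ ∈ S, ∑ j : Fin (m μ), algebraMap ℂ[X] (RatFunc ℂ) (r μ j) *
      (algebraMap ℂ[X] (RatFunc ℂ) (X - C μ))⁻¹ ^ (j.1 + 1) =
      ∑ μ ∈ S, ∑ i ∈ Finset.Icc 1 (m μ),
        RatFunc.C (a μ i) / (RatFunc.X - RatFunc.C μ) ^ i := by
    refine Finset.sum_congr rfl fun μ hμ => ?_
    rw [← Finset.Ico_add_one_right_eq_Icc, Finset.sum_Ico_eq_sum_range, Nat.add_sub_cancel,
      Finset.sum_range]
    refine Finset.sum_congr rfl fun j _ => ?_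
    rw [hr' μ hμ j, RatFunc.algebraMap_C, map_sub, RatFunc.algebraMap_X, RatFunc.algebraMap_C,
      inv_pow, ← div_eq_mul_inv, add_comm 1]
  have hprod : algebraMap ℂ[X] (RatFunc ℂ) (P.map (algebraMap ℝ ℂ)) * ∏ μ ∈ S,
      (algebraMap ℂ[X] (RatFunc ℂ) (X - C μ))⁻¹ ^ m μ = 1 := by
    rw [hP, map_prod, ← Finset.prod_mul_distrib]
    refine Finset.prod_eq_one fun μ _ => ?_
    rw [map_pow, ← mul_pow, mul_inv_cancel₀ (RatFunc.algebraMap_ne_zero (X_sub_C_ne_zero μ)),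
      one_pow]
  have h1 := congrArg (algebraMap ℂ[X] (RatFunc ℂ) (P.map (algebraMap ℝ ℂ)) * ·) h
  simp only [map_one, one_mul, hprod, hsum, mul_add, mul_sum_partialFraction hP] at h1
  rw [← map_mul, ← map_add, eq_comm, map_eq_one_iff _ (RatFunc.algebraMap_injective ℂ)] at h1
  -- The quotient vanishes for reasons of degree: `P` divides neither `1` nor a remainder.
  have hdeg : 0 < (P.map (algebraMap ℝ ℂ)).degree := by
    rw [degree_map]; exact natDegree_pos_iff_degree_pos.1 hd
  have hlt : (∑ μ ∈ S, ∑ i ∈ Finset.Icc 1 (m μ),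
      a μ i • (P.map (algebraMap ℝ ℂ) /ₘ (X - C μ) ^ i)).degree <
        (P.map (algebraMap ℝ ℂ)).degree := by
    have hmem : ∀ Q : ℂ[X], Q ∈ degreeLT ℂ P.natDegree ↔
        Q.degree < (P.map (algebraMap ℝ ℂ)).degree := fun Q => by
      rw [mem_degreeLT, degree_map, degree_eq_natDegree h0]
    rw [← hmem]
    refine Submodule.sum_mem _ fun μ _ => Submodule.sum_mem _ fun i hi =>
      Submodule.smul_mem _ _ ((hmem _).2 (degree_divByMonic_lt _ _ ?_ ?_))
    · exact (Polynomial.map_ne_zero_iff (algebraMap ℝ ℂ).injective).2 h0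
    · rw [degree_pow, degree_X_sub_C, nsmul_one]
      exact_mod_cast (Finset.mem_Icc.1 hi).1
  have hq : q = 0 := by
    by_contra hq
    have h2 : (P.map (algebraMap ℝ ℂ) * q).degree < (P.map (algebraMap ℝ ℂ)).degree := by
      rw [eq_sub_of_add_eq h1]
      exact (degree_sub_le _ _).trans_lt (max_lt (by rwa [degree_one]) hlt)
    exact absurd h2 (not_lt.2 (degree_le_mul_left _ hq))
  rw [hq, mul_zero, zero_add] at h1
  exact ⟨a, (isPartialFraction_iff h0 hP).2 h1⟩

end PartialFractions

/-! ### The adjoint action and complexification -/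

section Complexification

open Polynomial

theorem aeval_mem_of_mapsTo {R V : Type*} [CommRing R] [AddCommGroup V] [Module R V]
    {f : Module.End R V} {N : Submodule R V} (hf : ∀ x ∈ N, f x ∈ N) (Q : R[X]) {x : V}
    (hx : x ∈ N) : aeval f Q x ∈ N := by
  have hp : ∀ n : ℕ, (f ^ n) x ∈ N := fun n => by
    induction n with
    | zero => exact hx
    | succ n ih => rw [pow_succ']; exact hf _ ih
  rw [aeval_eq_sum_range, LinearMap.sum_apply]
  exact N.sum_mem fun n _ => N.smul_mem _ (hp n)

/-- Descent of membership from the complexification. -/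
theorem mem_of_one_tmul_mem_baseChange {V : Type*} [AddCommGroup V] [Module ℝ V]
    {N : Submodule ℝ V} {x : V} (hx : (1 : ℂ) ⊗ₜ[ℝ] x ∈ N.baseChange ℂ) : x ∈ N := by
  let r : ℂ ⊗[ℝ] V →ₗ[ℝ] V := TensorProduct.lid ℝ V ∘ₗ LinearMap.rTensor V Complex.reLm
  have h : ∀ t ∈ N.baseChange ℂ, ∀ c : ℂ, r (c • t) ∈ N := by
    intro t ht
    rw [Submodule.baseChange_eq_span] at ht
    induction ht using Submodule.span_induction with
    | mem t ht =>
      intro c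
      obtain ⟨y, hy, rfl⟩ := ht
      simp [r, TensorProduct.smul_tmul', N.smul_mem _ hy]
    | zero => intro c; rw [smul_zero, map_zero]; exact N.zero_mem
    | add s t _ _ hs ht => intro c; rw [smul_add, map_add]; exact N.add_mem (hs c) (ht c)
    | smul b t _ ht => intro c; rw [smul_smul]; exact ht _
  simpa [r] using h _ hx 1

theorem baseChange_mem_baseChange {V : Type*} [AddCommGroup V] [Module ℝ V]
    {N : Submodule ℝ V} {f : Module.End ℝ V} (hf : ∀ x ∈ N, f x ∈ N) {t : ℂ ⊗[ℝ] V}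
    (ht : t ∈ N.baseChange ℂ) : f.baseChange ℂ t ∈ N.baseChange ℂ := by
  rw [Submodule.baseChange_eq_span] at ht
  induction ht using Submodule.span_induction with
  | mem t ht =>
    obtain ⟨y, hy, rfl⟩ := ht
    exact Submodule.tmul_mem_baseChange_of_mem 1 (hf y hy)
  | zero => rw [map_zero]; exact Submodule.zero_mem _
  | add s t _ _ hs ht => rw [map_add]; exact Submodule.add_mem _ hs ht
  | smul b t _ ht => rw [map_smul]; exact Submodule.smul_mem _ _ ht

theorem aeval_baseChange_tmul {V : Type*} [AddCommGroup V] [Module ℝ V] (f : Module.End ℝ V)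
    (P : ℝ[X]) (x : V) :
    aeval (f.baseChange ℂ) (P.map (algebraMap ℝ ℂ)) ((1 : ℂ) ⊗ₜ[ℝ] x) = 1 ⊗ₜ aeval f P x := by
  rw [aeval_map_algebraMap]
  have h := aeval_algHom_apply (Module.End.baseChangeHom ℝ ℂ V) f P
  change aeval (f.baseChange ℂ) P = (aeval f P).baseChange ℂ at h
  rw [h, LinearMap.baseChange_tmul]

variable {E : Type*} [NormedAddCommGroup E] [NormedSpace ℝ E]
  {M : Type*} [TopologicalSpace M] [ChartedSpace E M] [IsManifold 𝓘(ℝ, E) ∞ M]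

theorem SkewEndo.IsLift.ad_mem_GT {φ : SkewEndo E M} {T : Ops E M} (hT : φ.IsLift T) {A : Ops E M}
    (hA : A ∈ GT E M) : ad T A ∈ GT E M := by
  obtain ⟨x, rfl⟩ := mem_GT_iff.1 hA
  exact mem_GT_iff.2 ⟨_, (hT.sections x).symm⟩

theorem SkewEndo.IsLift.evenPart_minimalOperator {φ : SkewEndo E M} {T : Ops E M} (hT : φ.IsLift T)
    (P : ℝ[X]) : evenPart (minimalOperator T P) = 0 := by
  let N : Submodule ℝ (Ops E M) :=
    { carrier := {A | parity E M * A * parity E M = -A}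
      add_mem' := fun {A B} hA hB => by
        change _ * (A + B) * _ = -(A + B)
        rw [mul_add, add_mul, show _ = -A from hA, show _ = -B from hB, neg_add]
      zero_mem' := by simp
      smul_mem' := fun c A hA => by
        change _ * (c • A) * _ = -(c • A)
        rw [mul_smul_comm, smul_mul_assoc, show _ = -A from hA, smul_neg] }
  have hN : ∀ A ∈ N, ad T A ∈ N := fun A hA => by
    change parity E M * gcomm T A * parity E M = -gcomm T A
    have hA' : parity E M * A * parity E M = -A := hA
    have hT' := oddPart_eq_zero_iff.1 hT.even
    rw [gcomm_of_even hT.even, mul_sub, sub_mul, parity_conj_mul, parity_conj_mul, hA', hT',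
      mul_neg, neg_mul]
    abel
  exact evenPart_eq_zero_iff.2 (aeval_mem_of_mapsTo hN P (x := deRham E M) parity_mul_deRham)

/-- Minimality is the condition that the minimal operator is a section of `𝕋M`. -/
theorem SkewEndo.IsLift.isMinimal_iff [FiniteDimensional ℝ E] [T2Space M] [Nontrivial E]
    {φ : SkewEndo E M} {T : Ops E M} (hT : φ.IsLift T) (P : ℝ[X]) :
    IsMinimal T P ↔ minimalOperator T P ∈ GT E M :=
  mem_GT_iff_derivedBracket (hT.evenPart_minimalOperator P)

theorem aeval_adC_deRhamC (T : Ops E M) (P : ℝ[X]) :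
    aeval (adC T) (P.map (algebraMap ℝ ℂ)) (deRhamC E M) = 1 ⊗ₜ minimalOperator T P :=
  aeval_baseChange_tmul _ _ _

theorem minimalOperator_mem_GT_iff (T : Ops E M) (P : ℝ[X]) : minimalOperator T P ∈ GT E M ↔
    aeval (adC T) (P.map (algebraMap ℝ ℂ)) (deRhamC E M) ∈ GTC E M := by
  rw [aeval_adC_deRhamC]
  exact ⟨Submodule.tmul_mem_baseChange_of_mem 1, mem_of_one_tmul_mem_baseChange⟩

theorem SkewEndo.IsLift.aeval_adC_mem_GTC {φ : SkewEndo E M} {T : Ops E M} (hT : φ.IsLift T)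
    (Q : ℂ[X]) {t : ℂ ⊗[ℝ] Ops E M} (ht : t ∈ GTC E M) : aeval (adC T) Q t ∈ GTC E M :=
  aeval_mem_of_mapsTo (fun _ h => baseChange_mem_baseChange (fun _ hA => hT.ad_mem_GT hA) h) Q ht

theorem aeval_X_sub_C_pow (T : Ops E M) (μ : ℂ) (n : ℕ) :
    aeval (adC T) ((X - C μ) ^ n) = (adC T - μ • 1) ^ n := by
  rw [map_pow, map_sub, aeval_X, aeval_C, Algebra.algebraMap_eq_smul_one]

/-- The components `∑ i, a_i Q_i(ad_T)(d)` add up to `d`. -/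
theorem sum_deRhamComponent (T : Ops E M) {P : ℝ[X]} (h0 : P ≠ 0) {S : Finset ℂ} {m : ℂ → ℕ}
    (hP : P.map (algebraMap ℝ ℂ) = ∏ μ ∈ S, (X - C μ) ^ m μ) {a : ℂ → ℕ → ℂ}
    (h : IsPartialFraction P S m a) :
    deRhamC E M = ∑ μ ∈ S, deRhamComponent T P μ (m μ) (a μ) := by
  have h1 := congrArg (fun Q => aeval (adC T) Q (deRhamC E M)) ((isPartialFraction_iff h0 hP).1 h)
  simp only [map_sum, map_smul, LinearMap.sum_apply, LinearMap.smul_apply, map_one,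
    Module.End.one_apply] at h1
  exact h1.symm

/-- If the minimal operator is a section, then so is every `(ad_T - μ)^{m(μ)} (d_μ)`, because
`(x - μ)^{m(μ)} Q_{μ,i}(x) = (x - μ)^{m(μ) - i} P(x)`. -/
theorem SkewEndo.IsLift.deRhamComponent_mem {φ : SkewEndo E M} {T : Ops E M} (hT : φ.IsLift T)
    {P : ℝ[X]} {S : Finset ℂ} {m : ℂ → ℕ}
    (hP : P.map (algebraMap ℝ ℂ) = ∏ μ ∈ S, (X - C μ) ^ m μ)
    (h : minimalOperator T P ∈ GT E M) (a : ℕ → ℂ) {μ : ℂ} (hμ : μ ∈ S) :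
    ((adC T - μ • 1) ^ m μ) (deRhamComponent T P μ (m μ) a) ∈ GTC E M := by
  rw [minimalOperator_mem_GT_iff] at h
  rw [deRhamComponent, map_sum, ← aeval_X_sub_C_pow]
  refine Submodule.sum_mem _ fun i hi => ?_
  have hi := (Finset.mem_Icc.1 hi).2
  rw [map_smul, ← Module.End.mul_apply, ← map_mul, ← pow_sub_mul_pow _ hi, mul_assoc,
    pow_mul_divByMonic hP hμ hi, map_mul, Module.End.mul_apply]
  exact Submodule.smul_mem _ _ (hT.aeval_adC_mem_GTC _ h)

/-- A decomposition of `d` into generalized eigenvectors modulo sections makes `P(ad_T)(d)` a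
section. -/
theorem SkewEndo.IsLift.minimalOperator_mem {φ : SkewEndo E M} {T : Ops E M} (hT : φ.IsLift T)
    {P : ℝ[X]} {S : Finset ℂ} {m : ℂ → ℕ}
    (hP : P.map (algebraMap ℝ ℂ) = ∏ μ ∈ S, (X - C μ) ^ m μ)
    {D : ℂ → ℂ ⊗[ℝ] Ops E M} (hD : deRhamC E M = ∑ μ ∈ S, D μ)
    (h : ∀ μ ∈ S, ((adC T - μ • 1) ^ m μ) (D μ) ∈ GTC E M) : minimalOperator T P ∈ GT E M := by
  rw [minimalOperator_mem_GT_iff, hD, map_sum]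
  refine Submodule.sum_mem _ fun μ hμ => ?_
  rw [← pow_mul_divByMonic hP hμ le_rfl, mul_comm, map_mul, Module.End.mul_apply,
    aeval_X_sub_C_pow]
  exact hT.aeval_adC_mem_GTC _ (h μ hμ)

end Complexification

/-- A polynomial structure exists only on a manifold of positive dimension. -/
theorem nontrivial_of_isPolynomialStructure {E : Type*} [NormedAddCommGroup E] [NormedSpace ℝ E]
    {M : Type*} [TopologicalSpace M] [ChartedSpace E M] [IsManifold 𝓘(ℝ, E) ∞ M] [Nonempty M]
    {φ : SkewEndo E M} {P : Polynomial ℝ} (hφ : φ.IsPolynomialStructure P) : Nontrivial E := by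
  by_contra hE
  rw [not_nontrivial_iff_subsingleton] at hE
  obtain ⟨p⟩ := ‹Nonempty M›
  have : Subsingleton (E →L[ℝ] ℝ) := ⟨fun f g => by
    ext x; rw [Subsingleton.elim x 0, map_zero, map_zero]⟩
  have h1 := hφ.2.1
  rw [← hφ.2.2 p, minpoly.subsingleton, Polynomial.natDegree_one] at h1
  exact lt_irrefl _ h1

end GenGeom

end

theorem mainTheorem4 {E : Type*} [NormedAddCommGroup E] [NormedSpace ℝ E] [FiniteDimensional ℝ E]
    {M : Type*} [TopologicalSpace M] [T2Space M] [SecondCountableTopology M] [ChartedSpace E M]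
    [IsManifold 𝓘(ℝ, E) ∞ M]
    (φ : GenGeom.SkewEndo E M) (P : Polynomial ℝ) (hφ : φ.IsPolynomialStructure P)
    (S : Finset ℂ) (m : ℂ → ℕ) (hS : (S : Set ℂ) = φ.spectrum)
    (hP : P.map (algebraMap ℝ ℂ) = ∏ μ ∈ S, (Polynomial.X - Polynomial.C μ) ^ m μ) :
    ∃ T : GenGeom.Ops E M, φ.IsLift T ∧ (∀ T' : GenGeom.Ops E M, φ.IsLift T' → T' = T) ∧
      (GenGeom.IsMinimal T P ↔
        ∃ D : ℂ → ℂ ⊗[ℝ] GenGeom.Ops E M,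
          GenGeom.deRhamC E M = ∑ μ ∈ S, D μ ∧
          ∀ μ ∈ S, ((GenGeom.adC T - μ • 1) ^ m μ) (D μ) ∈ GenGeom.GTC E M) ∧
      (∃ a : ℂ → ℕ → ℂ, GenGeom.IsPartialFraction P S m a) ∧
      ∀ a : ℂ → ℕ → ℂ, GenGeom.IsPartialFraction P S m a →
        GenGeom.deRhamC E M = ∑ μ ∈ S, GenGeom.deRhamComponent T P μ (m μ) (a μ) ∧
        (GenGeom.IsMinimal T P ↔
          ∀ μ ∈ S, ((GenGeom.adC T - μ • 1) ^ m μ)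
            (GenGeom.deRhamComponent T P μ (m μ) (a μ)) ∈ GenGeom.GTC E M) := by
  -- On the empty manifold there are no eigenvalues, so `P` would be constant.
  have : Nonempty M := by
    by_contra hM
    rw [not_nonempty_iff] at hM
    have hS0 : S = ∅ := by
      rw [← Finset.coe_eq_empty, hS]
      exact Set.eq_empty_of_forall_notMem fun μ ⟨p, _⟩ => isEmptyElim p
    have h1 := congrArg Polynomial.natDegree hP
    rw [hS0, Finset.prod_empty, Polynomial.natDegree_map, Polynomial.natDegree_one] at h1
    exact hφ.2.1.ne' h1
  have : Nontrivial E := GenGeom.nontrivial_of_isPolynomialStructure hφ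
  have hT := GenGeom.isLift_lift φ
  have h0 : P ≠ 0 := hφ.1.ne_zero
  obtain ⟨a₀, ha₀⟩ := GenGeom.exists_isPartialFraction hφ.2.1 hP
  refine ⟨GenGeom.lift φ, hT, fun T' hT' => hT.unique hT', ?_, ⟨a₀, ha₀⟩,
    fun a ha => ⟨GenGeom.sum_deRhamComponent _ h0 hP ha, ?_⟩⟩ <;>
  rw [hT.isMinimal_iff]
  · refine ⟨fun h => ⟨_, GenGeom.sum_deRhamComponent _ h0 hP ha₀, fun μ hμ =>
      hT.deRhamComponent_mem hP h _ hμ⟩, ?_⟩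
    rintro ⟨D, hD, h⟩
    exact hT.minimalOperator_mem hP hD h
  · exact ⟨fun h μ hμ => hT.deRhamComponent_mem hP h _ hμ,
      hT.minimalOperator_mem hP (GenGeom.sum_deRhamComponent _ h0 hP ha)⟩
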